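/- **Models.** Let $G=(V,E)$ be a graph with $n=|V|$ vertices that carry distinct identifiers of $O(\log n)$ bits. In the $\mathsf{LOCAL}$ model, each vertex $v$ initially knows its identifier, its degree, $n$, the maximum degree of $G$, its input string and its private random bits; computation takes place in synchronous rounds, in each of which every vertex may send a message of unbounded size to each of its neighbors (addressed by identifier), and local computation is unbounded. At the end each vertex outputs a bit string. In the $\mathsf{CONGESTED}\text{-}\mathsf{CLIQUE}$ model, each vertex has the same initial knowledge, moreover knows the identifiers of its neighbors in $G$ and has additional private random coins, and in each round it sends one message of $O(\log n)$ bits to each of the other $n-1$ vertices. **Parameters.** Let $\mathcal{A}$ be a $\tau$-round $\mathsf{LOCAL}$ algorithm in which the input and the private random bits used by a vertex take at most $\ell_{\mathrm{in}}$ bits together. Every vertex $v$ initially knows (in both models) a set $N_*(v)\subseteq N(v)$ of neighbors, $|N_*(v)|\le\Delta_*$. We consider executions of $\mathcal{A}$ in which every vertex $v$ receives messages only from vertices in $N_*(v)$ and in which every output takes at most $\ell_{\mathrm{out}}$ bits. **Lemma.** Suppose that 1. $\Delta_*^{\tau}\cdot\log\left(\Delta_*+\ell_{\mathrm{in}}/\log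 n\right)=O(\log n)$, 2. $\ell_{\mathrm{in}}=O(n)$, 3. $\ell_{\mathrm{out}}=O(\log n)$, and that $\Delta_*\neq 1$ or $\tau=O(1)$. Then $\mathcal{A}$ can be simulated with high probability in $O(1)$ rounds of $\mathsf{CONGESTED}\text{-}\mathsf{CLIQUE}$. Precisely: for every real $C$ and every $c\in\mathbb{N}$ there is $K\in\mathbb{N}$ such that the following holds for all $n,\tau,\Delta_*,\ell_{\mathrm{in}},\ell_{\mathrm{out}}$, all numbers $\rho$ of random bits per vertex and all identifier lengths that satisfy these bounds with the constant $C$ (identifier length at most $C\log_2 n$, and $\Delta_*\ne1$ or $\tau\le C$), and for every $\mathsf{LOCAL}$ algorithm $\mathcal{A}$. There is a randomized $\mathsf{CONGESTED}\text{-}\mathsf{CLIQUE}$ algorithm $\mathcal{S}$, with at most $K$ rounds and messages of $K\lceil\log_2 n\rceil$ bits, such that for every $n$-vertex graph, every assignment of identifiers, sets $N_*(v)$, inputs and random bits of $\mathcal{A}$ as above, with probability at least $1-n^{-c}$ over the additional coins of $\mathcal{S}$, every vertex outputs in $\mathcal{S}$ exactly what it outputs after $\tau$ rounds of $\mathcal{A}$.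 (As this holds for every fixed outcome of the random bits of $\mathcal{A}$, it holds in particular when these are uniformly random.) -/

import Mathlib

/-- What a vertex knows before the first round of a `LOCAL` algorithm: its identifier, its degree,
the maximum degree of the graph, the identifiers of the vertices of its set `N_*`, its input and
its private random bits.  (The number `n` of vertices is fixed before the algorithm is chosen.) -/
structure LocalView where
  id : ℕ
  degree : ℕ
  maxDegree : ℕ
  nstarIds : Finset ℕ
  input : List Bool
  rand : List Bool

/-- What a vertex knows before the first round of a `CONGESTED-CLIQUE` algorithm: the same data,
and moreover its adjacent edges in the input graph, that is, the identifiers of its neighbors. -/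
structure CliqueView extends LocalView where
  neighborIds : Finset ℕ

/-- An `n`-vertex input graph with distinct `idBits`-bit identifiers, sets `N_*(v) ⊆ N(v)` of size
at most `Δstar`, input strings, and `ρ` random bits per vertex, where the input and the
random bits of a vertex take at most `ℓin` bits together. -/
structure NetworkInstance (n idBits Δstar ρ ℓin : ℕ) where
  graph : SimpleGraph (Fin n)
  id : Fin n → ℕ
  id_injective : Function.Injective id
  id_lt : ∀ v, id v < 2 ^ idBits
  nstar : Fin n → Finset (Fin n)
  adj_of_mem_nstar : ∀ v, ∀ u ∈ nstar v, graph.Adj v u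
  card_nstar_le : ∀ v, (nstar v).card ≤ Δstar
  input : Fin n → List Bool
  rand : Fin n → Fin ρ → Bool
  length_input_add_le : ∀ v, (input v).length + ρ ≤ ℓin

namespace NetworkInstance

variable {n idBits Δstar ρ ℓin : ℕ}

open Classical in
/-- The set `N(v)` of neighbors of `v`. -/
noncomputable def neighbors (I : NetworkInstance n idBits Δstar ρ ℓin) (v : Fin n) :
    Finset (Fin n) :=
  Finset.univ.filter (fun u => I.graph.Adj v u)

/-- The initial knowledge of `v` in the `LOCAL` model. -/
noncomputable def localView (I : NetworkInstance n idBits Δstar ρ ℓin) (v : Fin n) :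
    LocalView where
  id := I.id v
  degree := (I.neighbors v).card
  maxDegree := Finset.univ.sup (fun w => (I.neighbors w).card)
  nstarIds := (I.nstar v).image I.id
  input := I.input v
  rand := List.ofFn (I.rand v)

/-- The initial knowledge of `v` in the `CONGESTED-CLIQUE` model. -/
noncomputable def cliqueView (I : NetworkInstance n idBits Δstar ρ ℓin) (v : Fin n) :
    CliqueView where
  toLocalView := I.localView v
  neighborIds := (I.neighbors v).image I.id

end NetworkInstance

/-- An algorithm in the `LOCAL` model: unbounded local computation and messages of unbounded size.
In each round, `send s i` is what a vertex in state `s` sends to its neighbor with identifier `i`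
(`none` if it sends nothing to that neighbor), and the next state is computed by `recv` from the
current state and the set of the received messages, each labelled with the sender's identifier.
The random bits are part of the initial knowledge. -/
structure LocalAlgorithm where
  State : Type
  Msg : Type
  init : LocalView → State
  send : State → ℕ → Option Msg
  recv : State → Set (ℕ × Msg) → State
  output : State → List Bool

namespace LocalAlgorithm

variable {n idBits Δstar ρ ℓin : ℕ}

/-- The state of each vertex after `t` rounds. -/
noncomputable def stateAt (A : LocalAlgorithm) (I : NetworkInstance n idBits Δstar ρ ℓin) :
    ℕ → Fin n → A.State
  | 0, v => A.init (I.localView v)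
  | t + 1, v => A.recv (A.stateAt I t v)
      {x | ∃ u, I.graph.Adj v u ∧ x.1 = I.id u ∧
        A.send (A.stateAt I t u) (I.id v) = some x.2}

/-- The output of `v` when the algorithm is run for `τ` rounds. -/
noncomputable def outputAfter (A : LocalAlgorithm) (I : NetworkInstance n idBits Δstar ρ ℓin)
    (τ : ℕ) (v : Fin n) : List Bool :=
  A.output (A.stateAt I τ v)

/-- In the `τ` rounds of the algorithm, each `v` only receives messages from `N_*(v)`. -/
def OnlyReceivesFromNstar (A : LocalAlgorithm) (I : NetworkInstance n idBits Δstar ρ ℓin)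
    (τ : ℕ) : Prop :=
  ∀ t < τ, ∀ v u, I.graph.Adj v u → u ∉ I.nstar v →
    A.send (A.stateAt I t u) (I.id v) = none

end LocalAlgorithm

/-- A randomized algorithm in the `CONGESTED-CLIQUE` model with `b`-bit messages: unbounded local
computation, `coinBits` private random coins at each vertex (besides the random bits
in the initial knowledge), and in each round one `b`-bit message from each vertex to each other
vertex; `send s i` is what a vertex in state `s` sends to the vertex with identifier `i`. -/
structure CliqueAlgorithm (b : ℕ) where
  State : Type
  coinBits : ℕ
  init : CliqueView → (Fin coinBits → Bool) → State
  send : State → ℕ → (Fin b → Bool)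
  recv : State → Set (ℕ × (Fin b → Bool)) → State
  output : State → List Bool

namespace CliqueAlgorithm

variable {n idBits Δstar ρ ℓin b : ℕ}

/-- The state of each vertex after `t` rounds, for given outcomes of the coins. -/
noncomputable def stateAt (S : CliqueAlgorithm b) (I : NetworkInstance n idBits Δstar ρ ℓin)
    (coins : Fin n → Fin S.coinBits → Bool) : ℕ → Fin n → S.State
  | 0, v => S.init (I.cliqueView v) (coins v)
  | t + 1, v => S.recv (S.stateAt I coins t v)
      {x | ∃ u, u ≠ v ∧ x.1 = I.id u ∧ x.2 = S.send (S.stateAt I coins t u) (I.id v)}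

/-- The output of `v` when the algorithm is run for `R` rounds. -/
noncomputable def outputAfter (S : CliqueAlgorithm b) (I : NetworkInstance n idBits Δstar ρ ℓin)
    (coins : Fin n → Fin S.coinBits → Bool) (R : ℕ) (v : Fin n) : List Bool :=
  S.output (S.stateAt I coins R v)

/-- The probability of an event when all coins of all `n` vertices are fair and independent. -/
noncomputable def coinProb (S : CliqueAlgorithm b) (n : ℕ)
    (E : Set (Fin n → Fin S.coinBits → Bool)) : ℝ :=
  (E.ncard : ℝ) / (Fintype.card (Fin n → Fin S.coinBits → Bool) : ℝ)

end CliqueAlgorithm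

/-! ### Ranks of identifiers as common addresses. -/

section Simulation

/-! After `τ` rounds the state of `v` depends only on the local views in its ball of radius `τ`
along the sets `N_*` (`simState_eq`), so it suffices that some vertex collects this ball and tells
`v` the output. The simulation is deterministic; probability only serves to prove that a
combinatorial object exists.

Let `X = Δstar + ℓin / log n`, so that a view has `O(X log n)` bits, and let `r` be a large constant
depending on `C`. Three rounds let every vertex read what many vertices of its choice know
(`Learnable.read`), so the known radius grows by one in three rounds (`know_succ`). If `τ ≤ r` this
is enough, because `Δstar ^ τ * X = O(n)` (`pow_mul_le_of_mul_logb_le`).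

If `τ > r`, growth stops at radius `r`, where the knowledge of a vertex fits into `Y` messages. The
ball of radius `τ - r` has at most `m = 2 * Δstar ^ (τ - r)` vertices. A family of `n` sets of at
most `n / Y` ranks, fixed in advance, covers every set of `m` ranks (`exists_covering_family`). The
vertex of rank `p` reads the `r`-balls of the `p`-th set. For each `v`, some `p` covers the ball of
radius `τ - r`, hence sees the whole `τ`-ball (`ball_subset_add`), notices this (`determines_iff`)
and sends the output to `v`. Such a family exists because a large `r` makes `m * log X` a small
fraction of `log n`, whence `(4 * Y) ^ m ≤ n ^ (1/4)` (`covering_parameters`). -/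

open Classical in
/-- The number of elements of `ids` that are smaller than `x`. -/
noncomputable def rank (ids : Set ℕ) (x : ℕ) : ℕ := Nat.count (· ∈ ids) x

theorem nth_rank {ids : Set ℕ} {x : ℕ} (hx : x ∈ ids) : Nat.nth (· ∈ ids) (rank ids x) = x := by
  classical
  exact Nat.nth_count (p := (· ∈ ids)) hx

theorem rank_lt_ncard {ids : Set ℕ} (hf : ids.Finite) {x : ℕ} (hx : x ∈ ids) :
    rank ids x < ids.ncard := by
  classical
  rw [Set.ncard_eq_toFinset_card _ hf]
  exact Nat.count_lt_card (p := (· ∈ ids)) hf hx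

namespace NetworkInstance

variable {n idBits Δstar ρ ℓin : ℕ}

open Classical in
/-- The family `F`, indexed by identifiers instead of vertices. -/
noncomputable def lookup {β : Type} (I : NetworkInstance n idBits Δstar ρ ℓin) (F : Fin n → β)
    (x : ℕ) : Option β :=
  if h : ∃ u, I.id u = x then some (F h.choose) else none

theorem lookup_id {β : Type} (I : NetworkInstance n idBits Δstar ρ ℓin) (F : Fin n → β)
    (u : Fin n) : I.lookup F (I.id u) = some (F u) := by
  have h : ∃ w, I.id w = I.id u := ⟨u, rfl⟩
  rw [lookup, dif_pos h, I.id_injective h.choose_spec]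

/-- The rank of the identifier of `v` among all identifiers. -/
noncomputable def pos (I : NetworkInstance n idBits Δstar ρ ℓin) (v : Fin n) : ℕ :=
  rank (Set.range I.id) (I.id v)

theorem pos_lt (I : NetworkInstance n idBits Δstar ρ ℓin) (v : Fin n) : I.pos v < n := by
  have h := rank_lt_ncard (Set.finite_range I.id) (Set.mem_range_self v)
  rwa [← Set.image_univ, Set.ncard_image_of_injective _ I.id_injective, Set.ncard_univ,
    Nat.card_fin, Set.image_univ] at h

theorem nth_pos (I : NetworkInstance n idBits Δstar ρ ℓin) (v : Fin n) :
    Nat.nth (· ∈ Set.range I.id) (I.pos v) = I.id v :=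
  nth_rank (Set.mem_range_self v)

theorem pos_injective (I : NetworkInstance n idBits Δstar ρ ℓin) : Function.Injective I.pos := by
  intro u v h
  apply I.id_injective
  rw [← nth_pos, ← nth_pos, h]

theorem exists_pos_eq (I : NetworkInstance n idBits Δstar ρ ℓin) {p : ℕ} (hp : p < n) :
    ∃ v, I.pos v = p := by
  have h : Function.Injective fun v => (⟨I.pos v, I.pos_lt v⟩ : Fin n) := fun u v h =>
    I.pos_injective (by simpa using h)
  obtain ⟨v, hv⟩ := (Finite.injective_iff_surjective.1 h) ⟨p, hp⟩
  exact ⟨v, by simpa using hv⟩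

end NetworkInstance

/-! ### Composable deterministic protocols. -/

variable {n idBits Δstar ρ ℓin b R : ℕ}

/-- In some deterministic algorithm with `b`-bit messages, after `R` rounds every vertex `v` of
every instance `I` knows its local view, the set of all identifiers, and `f I v`. -/
def Learnable (b R : ℕ) {α : Type} (f : NetworkInstance n idBits Δstar ρ ℓin → Fin n → α) : Prop :=
  ∃ (S : CliqueAlgorithm b) (g : S.State → LocalView × Set ℕ × α), ∀ I coins v,
    g (S.stateAt I coins R v) = (I.localView v, Set.range I.id, f I v)

namespace Learnable

/-- The sender labels of one round already reveal all other identifiers, so the content of the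
messages is irrelevant and `b = 0` is allowed. -/
theorem one : Learnable b 1 (fun (_ : NetworkInstance n idBits Δstar ρ ℓin) _ => ()) := by
  refine ⟨⟨LocalView × Set ℕ, 0, fun cv _ => (cv.toLocalView, ∅), fun _ _ _ => false,
    fun s X => (s.1, insert s.1.id (Prod.fst '' X)), fun _ => []⟩, fun s => (s.1, s.2, ()), ?_⟩
  intro I coins v
  simp only [CliqueAlgorithm.stateAt, NetworkInstance.cliqueView, Prod.mk.injEq, true_and, and_true]
  ext x
  simp only [Set.mem_insert_iff, Set.mem_image, Set.mem_ofPred_eq, Prod.exists, Set.mem_range]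
  constructor
  · rintro (rfl | ⟨y, m, ⟨u, -, rfl, -⟩, rfl⟩)
    · exact ⟨v, rfl⟩
    · exact ⟨u, rfl⟩
  · rintro ⟨u, rfl⟩
    by_cases h : u = v
    · exact Or.inl (by rw [h]; rfl)
    · exact Or.inr ⟨I.id u, _, ⟨u, h, rfl, rfl⟩, rfl⟩

theorem map {α β : Type} {f : NetworkInstance n idBits Δstar ρ ℓin → Fin n → α}
    (hf : Learnable b R f) {f' : NetworkInstance n idBits Δstar ρ ℓin → Fin n → β}
    (φ : LocalView → Set ℕ → α → β)
    (hφ : ∀ I v, f' I v = φ (I.localView v) (Set.range I.id) (f I v)) : Learnable b R f' := by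
  obtain ⟨S, g, h⟩ := hf
  refine ⟨S, fun s => ((g s).1, (g s).2.1, φ (g s).1 (g s).2.1 (g s).2.2), fun I coins v => ?_⟩
  simp [h I coins v, hφ]

/-- One further round, in which every vertex sends a message to every vertex. -/
theorem exchange {α : Type} {f : NetworkInstance n idBits Δstar ρ ℓin → Fin n → α}
    (hf : Learnable b R f) (msg : LocalView → Set ℕ → α → ℕ → (Fin b → Bool)) :
    Learnable b (R + 1) (fun I v => (f I v,
      I.lookup fun u => msg (I.localView u) (Set.range I.id) (f I u) (I.id v))) := by
  classical
  obtain ⟨S, g, h⟩ := hf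
  let msg' (s : S.State) : ℕ → (Fin b → Bool) := msg (g s).1 (g s).2.1 (g s).2.2
  -- The state carries a clock, which tells when to switch from `S` to the additional round;
  -- afterwards the received set is frozen.
  let T : CliqueAlgorithm b :=
    { State := (ℕ × S.State) ⊕ (S.State × Set (ℕ × (Fin b → Bool)))
      coinBits := S.coinBits
      init := fun cv c => Sum.inl (0, S.init cv c)
      send := fun s x => match s with
        | Sum.inl (t, s) => if t < R then S.send s x else msg' s x
        | Sum.inr _ => fun _ => false
      recv := fun s X => match s with
        | Sum.inl (t, s) => if t < R then Sum.inl (t + 1, S.recv s X) else Sum.inr (s, X)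
        | Sum.inr y => Sum.inr y
      output := fun _ => [] }
  have hT : ∀ (I : NetworkInstance n idBits Δstar ρ ℓin) (coins : Fin n → Fin S.coinBits → Bool)
      (t : ℕ), t ≤ R → ∀ v, T.stateAt I coins t v = Sum.inl (t, S.stateAt I coins t v) := by
    intro I coins t
    induction t with
    | zero => intro _ v; rfl
    | succ t ih =>
      intro ht v
      have ht' : t < R := ht
      simp only [CliqueAlgorithm.stateAt, ih ht'.le]
      simp only [T, if_pos ht']
  refine ⟨T, Sum.elim (fun s => ((g s.2).1, (g s.2).2.1, (g s.2).2.2, fun _ => none))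
    (fun s => ((g s.1).1, (g s.1).2.1, (g s.1).2.2, fun x =>
      -- No vertex sends to itself, so the message to oneself is computed locally.
      if x = (g s.1).1.id then some (msg' s.1 x)
      else if hx : ∃ m, (x, m) ∈ s.2 then some hx.choose else none)), fun I coins v => ?_⟩
  have hstate : T.stateAt I coins (R + 1) v = Sum.inr (S.stateAt I coins R v,
      {x | ∃ u, u ≠ v ∧ x.1 = I.id u ∧ x.2 = msg' (S.stateAt I coins R u) (I.id v)}) := by
    rw [CliqueAlgorithm.stateAt]
    simp only [hT I coins R le_rfl]
    simp [T]
  rw [hstate]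
  have hid : (I.localView v).id = I.id v := rfl
  simp only [Sum.elim_inr, h I coins, hid, msg', Set.mem_ofPred_eq, Prod.mk.injEq, true_and]
  funext x
  by_cases hx : ∃ u, I.id u = x
  · obtain ⟨u, rfl⟩ := hx
    rw [NetworkInstance.lookup_id]
    by_cases huv : u = v
    · subst huv
      simp
    · rw [if_neg (fun hh => huv (I.id_injective hh))]
      have hex : ∃ m, ∃ w, w ≠ v ∧ I.id u = I.id w ∧
          m = msg (I.localView w) (Set.range I.id) (f I w) (I.id v) := ⟨_, u, huv, rfl, rfl⟩
      rw [dif_pos hex]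
      obtain ⟨w, -, h1, h2⟩ := hex.choose_spec
      rw [h2, I.id_injective h1]
  · rw [if_neg (fun hh => hx ⟨v, hh.symm⟩), dif_neg, NetworkInstance.lookup, dif_neg hx]
    rintro ⟨m, u, -, h1, -⟩
    exact hx ⟨u, h1.symm⟩

theorem exists_algorithm {f : NetworkInstance n idBits Δstar ρ ℓin → Fin n → List Bool}
    (hf : Learnable b R f) : ∃ S : CliqueAlgorithm b, ∀ I coins v,
      S.outputAfter I coins R v = f I v := by
  obtain ⟨S, g, h⟩ := hf
  refine ⟨{ S with output := fun s => (g s).2.2 }, fun I coins v => ?_⟩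
  have hs : ∀ t v, CliqueAlgorithm.stateAt { S with output := fun s => (g s).2.2 } I coins t v =
      S.stateAt I coins t v := by
    intro t
    induction t with
    | zero => intro v; rfl
    | succ t ih => intro v; simp only [CliqueAlgorithm.stateAt, ih]
  simp only [CliqueAlgorithm.outputAfter, hs]
  rw [h I coins v]

end Learnable

theorem CliqueAlgorithm.coinProb_univ (S : CliqueAlgorithm b) (n : ℕ) :
    S.coinProb n Set.univ = 1 := by
  rw [CliqueAlgorithm.coinProb, Set.ncard_univ, Nat.card_eq_fintype_card]
  exact div_self (by exact_mod_cast Fintype.card_ne_zero)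

/-! ### Balls along the sets `N_*`. -/

namespace NetworkInstance

/-- The vertices from which `v` can be reached in `t` steps, each of which leads from a vertex of
some `N_*(u)` to `u`. -/
def ball (I : NetworkInstance n idBits Δstar ρ ℓin) : ℕ → Fin n → Finset (Fin n)
  | 0, v => {v}
  | t + 1, v => {v} ∪ (I.nstar v).biUnion (I.ball t)

theorem mem_ball_self (I : NetworkInstance n idBits Δstar ρ ℓin) (t : ℕ) (v : Fin n) :
    v ∈ I.ball t v := by
  cases t <;> simp [ball]

theorem mem_ball_succ {I : NetworkInstance n idBits Δstar ρ ℓin} {t : ℕ} {v x : Fin n} :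
    x ∈ I.ball (t + 1) v ↔ x = v ∨ ∃ u ∈ I.nstar v, x ∈ I.ball t u := by
  simp [ball]

theorem ball_subset_succ (I : NetworkInstance n idBits Δstar ρ ℓin) (t : ℕ) :
    ∀ v, I.ball t v ⊆ I.ball (t + 1) v := by
  induction t with
  | zero => intro v x hx; simp [ball] at hx; simp [hx, mem_ball_self]
  | succ t ih =>
    intro v x hx
    rw [mem_ball_succ] at hx ⊢
    exact hx.imp_right fun ⟨u, hu, h⟩ => ⟨u, hu, ih u h⟩

/-- This splits the radius `τ` into `τ - r`, handled by the covering, and `r`, handled by growing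
balls. -/
theorem ball_subset_add (I : NetworkInstance n idBits Δstar ρ ℓin) (s t : ℕ) :
    ∀ v, ∀ x ∈ I.ball (s + t) v, ∃ u ∈ I.ball s v, x ∈ I.ball t u := by
  induction s with
  | zero => intro v x hx; exact ⟨v, mem_ball_self _ _ _, by simpa using hx⟩
  | succ s ih =>
    intro v x hx
    rw [Nat.add_right_comm, mem_ball_succ] at hx
    obtain rfl | ⟨u, hu, h⟩ := hx
    · exact ⟨x, mem_ball_self _ _ _, mem_ball_self _ _ _⟩
    · obtain ⟨w, hw, hx⟩ := ih u x h
      exact ⟨w, mem_ball_succ.2 (Or.inr ⟨u, hu, hw⟩), hx⟩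

theorem ball_eq_singleton (I : NetworkInstance n idBits Δstar ρ ℓin) (h : ∀ v, I.nstar v = ∅)
    (t : ℕ) (v : Fin n) : I.ball t v = {v} := by
  cases t <;> simp [ball, h]

theorem card_ball_succ_le (I : NetworkInstance n idBits Δstar ρ ℓin) (t m : ℕ)
    (h : ∀ v, (I.ball t v).card ≤ m) (v : Fin n) : (I.ball (t + 1) v).card ≤ 1 + Δstar * m := by
  refine (Finset.card_union_le _ _).trans ?_
  rw [Finset.card_singleton]
  gcongr
  exact (Finset.card_biUnion_le_card_mul _ _ m fun u _ => h u).trans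
    (Nat.mul_le_mul_right _ (I.card_nstar_le v))

/-- This also works for `Δstar = 1`. It is applied to bounded radii, where the loss against `Δstar ^
t` is a constant factor. -/
theorem card_ball_le_succ_pow (I : NetworkInstance n idBits Δstar ρ ℓin) (t : ℕ) :
    ∀ v, (I.ball t v).card ≤ (Δstar + 1) ^ t := by
  induction t with
  | zero => intro v; simp [ball]
  | succ t ih =>
    intro v
    refine (I.card_ball_succ_le t _ ih v).trans ?_
    have : 1 ≤ (Δstar + 1) ^ t := Nat.one_le_pow _ _ (by omega)
    rw [pow_succ]
    nlinarith

theorem card_ball_le_two_mul_pow (I : NetworkInstance n idBits Δstar ρ ℓin) (hΔ : 2 ≤ Δstar)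
    (t : ℕ) : ∀ v, (I.ball t v).card ≤ 2 * Δstar ^ t := by
  -- The `- 1` is multiplied by `Δstar ≥ 2` in the induction step and so absorbs the center.
  suffices h : ∀ v, (I.ball t v).card ≤ 2 * Δstar ^ t - 1 from
    fun v => (h v).trans (Nat.sub_le _ _)
  induction t with
  | zero => intro v; simp [ball]
  | succ t ih =>
    intro v
    refine (I.card_ball_succ_le t _ ih v).trans ?_
    have : 1 ≤ Δstar ^ t := Nat.one_le_pow _ _ (by omega)
    rw [pow_succ]
    zify [show 1 ≤ 2 * Δstar ^ t by omega, show 1 ≤ 2 * (Δstar ^ t * Δstar) by nlinarith]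
    zify at hΔ
    nlinarith

open Classical in
/-- The local views of the vertices in the ball of radius `k` around `v`. -/
noncomputable def know (I : NetworkInstance n idBits Δstar ρ ℓin) (k : ℕ) (v : Fin n) :
    Finset LocalView :=
  (I.ball k v).image I.localView

theorem mem_know {I : NetworkInstance n idBits Δstar ρ ℓin} {k : ℕ} {v : Fin n} {a : LocalView} :
    a ∈ I.know k v ↔ ∃ u ∈ I.ball k v, I.localView u = a := by
  simp [know]

end NetworkInstance

/-! ### Replaying the algorithm from a set of views. -/

namespace LocalAlgorithm

open Classical in
/-- The local view with identifier `x` in a set of local views. -/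
noncomputable def viewOf (W : Set LocalView) (x : ℕ) : LocalView :=
  if h : ∃ a ∈ W, a.id = x then h.choose else ⟨0, 0, 0, ∅, [], []⟩

theorem viewOf_id (I : NetworkInstance n idBits Δstar ρ ℓin) {W : Set LocalView}
    (hW : W ⊆ Set.range I.localView) {v : Fin n} (hv : I.localView v ∈ W) :
    viewOf W (I.id v) = I.localView v := by
  have h : ∃ a ∈ W, a.id = I.id v := ⟨_, hv, rfl⟩
  rw [viewOf, dif_pos h]
  obtain ⟨h1, h2⟩ := h.choose_spec
  obtain ⟨u, hu⟩ := hW h1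
  rw [← hu] at h2 ⊢
  rw [I.id_injective (show I.id u = I.id v from h2)]

/-- Simulation of the algorithm from a set of local views, at the vertex with identifier `x`. -/
noncomputable def simState (A : LocalAlgorithm) (W : Set LocalView) : ℕ → ℕ → A.State
  | 0, x => A.init (viewOf W x)
  | t + 1, x => A.recv (A.simState W t x)
      {y | y.1 ∈ (viewOf W x).nstarIds ∧ A.send (A.simState W t y.1) x = some y.2}

/-- `W` contains the local views of all vertices on which the state of the vertex with
identifier `x` after `t` rounds depends. -/
def Determines (W : Set LocalView) : ℕ → ℕ → Prop
  | 0, x => ∃ a ∈ W, a.id = x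
  | t + 1, x => ∃ a ∈ W, a.id = x ∧ ∀ y ∈ a.nstarIds, Determines W t y

/-- Each view lists the identifiers of its `N_*`, so a set of views reveals by itself whether it is
sufficient. A vertex holding arbitrary views can thus tell whose outputs it may compute. -/
theorem determines_iff (I : NetworkInstance n idBits Δstar ρ ℓin) {W : Set LocalView}
    (hW : W ⊆ Set.range I.localView) (t : ℕ) :
    ∀ v, Determines W t (I.id v) ↔ ∀ u ∈ I.ball t v, I.localView u ∈ W := by
  have key : ∀ v, ∀ a ∈ W, a.id = I.id v → a = I.localView v := by
    intro v a ha h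
    obtain ⟨u, rfl⟩ := hW ha
    rw [I.id_injective (show I.id u = I.id v from h)]
  induction t with
  | zero =>
    intro v
    simp only [Determines, NetworkInstance.ball, Finset.mem_singleton, forall_eq]
    exact ⟨fun ⟨a, ha, h⟩ => key v a ha h ▸ ha, fun h => ⟨_, h, rfl⟩⟩
  | succ t ih =>
    intro v
    simp only [Determines, NetworkInstance.mem_ball_succ]
    constructor
    · rintro ⟨a, ha, h, hy⟩ u (rfl | ⟨w, hw, hu⟩)
      · exact key u a ha h ▸ ha
      · rw [key v a ha h] at hy
        exact (ih w).1 (hy _ (Finset.mem_image_of_mem _ hw)) u hu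
    · intro h
      refine ⟨_, h v (Or.inl rfl), rfl, fun y hy => ?_⟩
      obtain ⟨w, hw, rfl⟩ := Finset.mem_image.1 hy
      exact (ih w).2 fun u hu => h u (Or.inr ⟨w, hw, hu⟩)

/-- Neighbors outside `N_*` send nothing, so the replay may ignore them, and each round back in time
enlarges the relevant ball by one. -/
theorem simState_eq (A : LocalAlgorithm) (I : NetworkInstance n idBits Δstar ρ ℓin)
    {W : Set LocalView} (hW : W ⊆ Set.range I.localView) (t : ℕ)
    (hA : A.OnlyReceivesFromNstar I t) :
    ∀ v, (∀ u ∈ I.ball t v, I.localView u ∈ W) → A.simState W t (I.id v) = A.stateAt I t v := by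
  induction t with
  | zero => intro v h; simp [simState, stateAt, viewOf_id I hW (h v (I.mem_ball_self 0 v))]
  | succ t ih =>
    intro v h
    have hA' : A.OnlyReceivesFromNstar I t := fun s hs => hA s (hs.trans (Nat.lt_succ_self t))
    rw [simState, stateAt, ih hA' v fun u hu => h u (I.ball_subset_succ t v hu),
      viewOf_id I hW (h v (I.mem_ball_self _ v))]
    congr 1
    ext ⟨y, m⟩
    simp only [Set.mem_ofPred_eq, NetworkInstance.localView, Finset.mem_image]
    constructor
    · rintro ⟨⟨u, hu, rfl⟩, hs⟩
      rw [ih hA' u fun w hw => h w (NetworkInstance.mem_ball_succ.2 (Or.inr ⟨u, hu, hw⟩))] at hs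
      exact ⟨u, I.adj_of_mem_nstar v u hu, rfl, hs⟩
    · rintro ⟨u, hadj, rfl, hs⟩
      have hu : u ∈ I.nstar v := by
        by_contra hu
        rw [hA t (Nat.lt_succ_self t) v u hadj hu] at hs
        cases hs
      refine ⟨⟨u, hu, rfl⟩, ?_⟩
      rwa [ih hA' u fun w hw => h w (NetworkInstance.mem_ball_succ.2 (Or.inr ⟨u, hu, hw⟩))]

end LocalAlgorithm

/-! ### Bit encodings. -/

/-- The elements of `P` can be encoded by `w` bits. -/
def Codable {α : Type} (P : Set α) (w : ℕ) : Prop :=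
  ∃ e : α → (Fin w → Bool), Set.InjOn e P

namespace Codable

variable {α β : Type} {P : Set α} {Q : Set β} {w w' : ℕ}

theorem of_injOn (hQ : Codable Q w) (φ : α → β) (hφ : Set.InjOn φ P) (hm : Set.MapsTo φ P Q) :
    Codable P w := by
  obtain ⟨e, he⟩ := hQ
  exact ⟨e ∘ φ, he.comp hφ hm⟩

theorem mono (hP : Codable P w) (h : w ≤ w') : Codable P w' := by
  obtain ⟨e, he⟩ := hP
  refine ⟨fun a i => if hi : i.1 < w then e a ⟨i, hi⟩ else false, fun a ha c hc hac => ?_⟩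
  refine he ha hc (funext fun i => ?_)
  have := congrFun hac ⟨i, i.2.trans_le h⟩
  simpa using this

theorem prod (hP : Codable P w) (hQ : Codable Q w') : Codable (P ×ˢ Q) (w + w') := by
  obtain ⟨e, he⟩ := hP
  obtain ⟨e', he'⟩ := hQ
  refine ⟨fun x => Fin.append (e x.1) (e' x.2), fun x hx y hy hxy => Prod.ext ?_ ?_⟩
  · refine he hx.1 hy.1 (funext fun i => ?_)
    simpa using congrFun hxy (Fin.castAdd w' i)
  · refine he' hx.2 hy.2 (funext fun i => ?_)
    simpa using congrFun hxy (Fin.natAdd w i)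

theorem pi (hP : Codable P w) (m : ℕ) : Codable {g : Fin m → α | ∀ i, g i ∈ P} (m * w) := by
  obtain ⟨e, he⟩ := hP
  refine ⟨fun g i => e (g (finProdFinEquiv.symm i).1) (finProdFinEquiv.symm i).2,
    fun g hg h hh hgh => funext fun i => he (hg i) (hh i) (funext fun j => ?_)⟩
  simpa using congrFun hgh (finProdFinEquiv (i, j))

theorem option (hP : Codable P w) : Codable {o : Option α | ∀ a ∈ o, a ∈ P} (w + 1) := by
  obtain ⟨e, he⟩ := hP
  refine ⟨fun o => o.elim (fun _ => false) fun a => Fin.cons true (e a), ?_⟩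
  rintro (_ | a) ha (_ | c) hc hac
  · rfl
  · simpa using congrFun hac 0
  · simpa using congrFun hac 0
  · congr 1
    refine he (ha a rfl) (hc c rfl) (funext fun i => ?_)
    simpa using congrFun hac i.succ

/-- A list is determined by its first `m` optional entries; the extra bit per entry marks presence
and replaces a length field. -/
theorem list (hP : Codable P w) (m : ℕ) :
    Codable {l : List α | l.length ≤ m ∧ ∀ a ∈ l, a ∈ P} (m * (w + 1)) := by
  refine (hP.option.pi m).of_injOn (fun l i => l[i.1]?) ?_ ?_
  · intro l hl l' hl' h
    refine List.ext_getElem? fun i => ?_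
    by_cases hi : i < m
    · exact congrFun h ⟨i, hi⟩
    · rw [List.getElem?_eq_none (hl.1.trans (not_lt.1 hi)),
        List.getElem?_eq_none (hl'.1.trans (not_lt.1 hi))]
  · intro l hl i a ha
    exact hl.2 a (List.mem_of_getElem? ha)

theorem finset (hP : Codable P w) (m : ℕ) :
    Codable {s : Finset α | s.card ≤ m ∧ ∀ a ∈ s, a ∈ P} (m * (w + 1)) := by
  refine (hP.list m).of_injOn Finset.toList ?_ ?_
  · intro s _ t _ h
    ext a
    rw [← Finset.mem_toList, h, Finset.mem_toList]
  · intro s hs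
    exact ⟨by rw [Finset.length_toList]; exact hs.1, fun a ha => hs.2 a (Finset.mem_toList.1 ha)⟩

theorem nat_lt_two_pow (w : ℕ) : Codable {x : ℕ | x < 2 ^ w} w := by
  refine ⟨fun x i => x.testBit i, fun x hx y hy h => Nat.eq_of_testBit_eq fun i => ?_⟩
  by_cases hi : i < w
  · exact congrFun h ⟨i, hi⟩
  · have hw := Nat.pow_le_pow_right (n := 2) (by norm_num) (not_lt.1 hi)
    rw [Nat.testBit_lt_two_pow (lt_of_lt_of_le hx hw),
      Nat.testBit_lt_two_pow (lt_of_lt_of_le hy hw)]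

theorem bool : Codable (Set.univ : Set Bool) 1 :=
  ⟨fun x _ => x, fun _ _ _ _ h => congrFun h 0⟩

theorem exists_chunks (hP : Codable P w) {Y : ℕ} (h : w ≤ Y * b) :
    ∃ e : α → Fin Y → Fin b → Bool, Set.InjOn e P := by
  obtain ⟨e, he⟩ := hP.mono h
  refine ⟨fun a i j => e a (finProdFinEquiv (i, j)), fun a ha c hc hac => he ha hc ?_⟩
  funext i
  have := congrFun (congrFun hac (finProdFinEquiv.symm i).1) (finProdFinEquiv.symm i).2
  dsimp only at this
  rwa [Prod.mk.eta, Equiv.apply_symm_apply] at this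

end Codable

/-- The number of bits that suffice for a local view. -/
def viewBits (n idBits Δstar ℓin : ℕ) : ℕ :=
  idBits + (Nat.clog 2 n + 1 + (Nat.clog 2 n + 1 +
    (Δstar * (idBits + 1) + (ℓin * 2 + ℓin * 2))))

theorem codable_localView (n idBits Δstar ρ ℓin : ℕ) :
    Codable {a : LocalView | ∃ (I : NetworkInstance n idBits Δstar ρ ℓin) (v : Fin n),
      I.localView v = a} (viewBits n idBits Δstar ℓin) := by
  refine ((Codable.nat_lt_two_pow idBits).prod ((Codable.nat_lt_two_pow (Nat.clog 2 n + 1)).prod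
    ((Codable.nat_lt_two_pow (Nat.clog 2 n + 1)).prod
    (((Codable.nat_lt_two_pow idBits).finset Δstar).prod
    ((Codable.bool.list ℓin).prod (Codable.bool.list ℓin)))))).of_injOn
    (fun a => (a.id, a.degree, a.maxDegree, a.nstarIds, a.input, a.rand)) ?_ ?_
  · rintro ⟨⟩ _ ⟨⟩ _ h
    simpa using h
  · rintro a ⟨I, v, rfl⟩
    have hn : n < 2 ^ (Nat.clog 2 n + 1) :=
      (Nat.le_pow_clog one_lt_two n).trans_lt (Nat.pow_lt_pow_right one_lt_two (Nat.lt_succ_self _))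
    have hdeg : ∀ w, (I.neighbors w).card < 2 ^ (Nat.clog 2 n + 1) := fun w =>
      ((Finset.card_le_univ _).trans_eq (Fintype.card_fin n)).trans_lt hn
    have hlen := I.length_input_add_le v
    refine ⟨I.id_lt v, hdeg v, ?_, ⟨Finset.card_image_le.trans (I.card_nstar_le v), ?_⟩,
      ⟨(Nat.le_add_right _ _).trans hlen, fun _ _ => trivial⟩,
      ⟨by simp only [NetworkInstance.localView, List.length_ofFn]; omega, fun _ _ => trivial⟩⟩
    · change Finset.univ.sup (fun w => (I.neighbors w).card) < _
      exact (Finset.sup_lt_iff (Nat.two_pow_pos _)).2 fun w _ => hdeg w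
    · intro x hx
      obtain ⟨u, -, rfl⟩ := Finset.mem_image.1 hx
      exact I.id_lt u

theorem codable_know (n idBits Δstar ρ ℓin k : ℕ) :
    Codable {s : Finset LocalView | ∃ (I : NetworkInstance n idBits Δstar ρ ℓin) (v : Fin n),
      I.know k v = s} ((Δstar + 1) ^ k * (viewBits n idBits Δstar ℓin + 1)) := by
  classical
  refine ((codable_localView n idBits Δstar ρ ℓin).finset ((Δstar + 1) ^ k)).of_injOn id
    (Set.injOn_id _) ?_
  rintro s ⟨I, v, rfl⟩
  refine ⟨Finset.card_image_le.trans (I.card_ball_le_succ_pow k v), fun a ha => ?_⟩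
  obtain ⟨u, -, hu⟩ := NetworkInstance.mem_know.1 ha
  exact ⟨I, u, hu⟩

/-! ### Reading, growing balls and delivering outputs. -/

namespace NetworkInstance

theorem lookup_eq_some {β : Type} {I : NetworkInstance n idBits Δstar ρ ℓin} {F : Fin n → β}
    {x : ℕ} {y : β} (h : I.lookup F x = some y) : ∃ u, I.id u = x ∧ F u = y := by
  unfold lookup at h
  split_ifs at h with hx
  exact ⟨_, hx.choose_spec, by simpa using h⟩

end NetworkInstance

namespace Learnable

open Classical in
/-- If what the vertices know fits into `Y` messages, then in three rounds every vertex can read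
what `Q` vertices of its choice (given by the ranks of their identifiers) know, if `Y * Q ≤ n`:
the message number `i` of the request number `j` is delivered by the vertex of rank `j * Y + i`. -/
theorem read {α : Type} [Nonempty α] {f : NetworkInstance n idBits Δstar ρ ℓin → Fin n → α}
    (hf : Learnable b R f) (hn : n ≤ 2 ^ b) {w Y Q : ℕ}
    (hcode : Codable {a | ∃ I v, f I v = a} w) (hw : w ≤ Y * b) (hYQ : Y * Q ≤ n) (hY : 0 < Y)
    (req : LocalView → Set ℕ → Finset ℕ)
    (hreq : ∀ (I : NetworkInstance n idBits Δstar ρ ℓin) v,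
      (req (I.localView v) (Set.range I.id)).card ≤ Q) :
    ∃ h : NetworkInstance n idBits Δstar ρ ℓin → Fin n → ℕ → α,
      Learnable b (R + 3) (fun I v => (f I v, h I v)) ∧
      ∀ I v u, I.pos u ∈ req (I.localView v) (Set.range I.id) → h I v (I.pos u) = f I u := by
  obtain ⟨e, he⟩ := hcode.exists_chunks hw
  -- A rank is less than `n ≤ 2 ^ b` and so fits into one message.
  obtain ⟨c, hc⟩ := (Codable.nat_lt_two_pow b)
  let d : (Fin b → Bool) → ℕ := Function.invFunOn c {x | x < 2 ^ b}
  have hd : ∀ x, x < 2 ^ b → d (c x) = x := fun x hx => hc.leftInvOn_invFunOn hx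
  let name (ids : Set ℕ) (x : ℕ) : ℕ := Nat.nth (· ∈ ids) x
  -- Round one: the vertex of rank `q` receives piece number `q % Y` from everyone, whoever will be
  -- asked for.
  let f1 := fun (I : NetworkInstance n idBits Δstar ρ ℓin) (v : Fin n) => (f I v,
    I.lookup fun u => e (f I u) ⟨rank (Set.range I.id) (I.id v) % Y, Nat.mod_lt _ hY⟩)
  have hf1 : Learnable b (R + 1) f1 :=
    hf.exchange fun _ ids a x => e a ⟨rank ids x % Y, Nat.mod_lt _ hY⟩
  -- Round two: `v` tells the vertex of rank `q` the rank requested as number `q / Y`.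
  let f2 := fun (I : NetworkInstance n idBits Δstar ρ ℓin) (v : Fin n) => (f1 I v,
    I.lookup fun u => c (Nat.nth (· ∈ (req (I.localView u) (Set.range I.id) : Set ℕ))
      (rank (Set.range I.id) (I.id v) / Y)))
  have hf2 : Learnable b (R + 2) f2 :=
    hf1.exchange fun a ids _ x => c (Nat.nth (· ∈ (req a ids : Set ℕ)) (rank ids x / Y))
  -- Round three: the stored piece of the requested vertex is returned.
  let m3 (ids : Set ℕ) (a : (α × (ℕ → Option (Fin b → Bool))) × (ℕ → Option (Fin b → Bool)))
      (x : ℕ) : Fin b → Bool :=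
    (a.1.2 (name ids (d ((a.2 x).getD fun _ => false)))).getD fun _ => false
  have hf3 := hf2.exchange fun _ ids a x => m3 ids a x
  let h := fun (I : NetworkInstance n idBits Δstar ρ ℓin) (v : Fin n) (p : ℕ) =>
    Function.invFunOn e {a | ∃ I v, f I v = a} fun i =>
      ((I.lookup fun u => m3 (Set.range I.id) (f2 I u) (I.id v)) (name (Set.range I.id)
        (rank (req (I.localView v) (Set.range I.id)) p * Y + i.1))).getD fun _ => false
  refine ⟨h, hf3.map (fun a ids y => (y.1.1.1, fun p =>
    Function.invFunOn e {a | ∃ I v, f I v = a} fun i =>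
      (y.2 (name ids (rank (req a ids) p * Y + i.1))).getD fun _ => false))
    fun I v => rfl, ?_⟩
  intro I v u hu
  set s := req (I.localView v) (Set.range I.id) with hs
  have hj : rank s (I.pos u) < Q := by
    refine lt_of_lt_of_le (rank_lt_ncard s.finite_toSet hu) ?_
    rw [Set.ncard_coe_finset]
    exact hreq I v
  set j := rank s (I.pos u) with hjdef
  have hrec : (fun i : Fin Y => ((I.lookup fun u => m3 (Set.range I.id) (f2 I u) (I.id v))
      (name (Set.range I.id) (j * Y + i.1))).getD fun _ => false) = e (f I u) := by
    funext i
    have hlt : j * Y + i.1 < n := by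
      have : (j + 1) * Y ≤ Q * Y := Nat.mul_le_mul_right _ hj
      have := i.2
      nlinarith
    obtain ⟨x, hx⟩ := I.exists_pos_eq hlt
    have hdiv : (j * Y + i.1) / Y = j := by
      rw [Nat.mul_comm, Nat.mul_add_div hY, Nat.div_eq_of_lt i.2, Nat.add_zero]
    have hmod : (j * Y + i.1) % Y = i.1 := by
      rw [Nat.mul_comm, Nat.mul_add_mod, Nat.mod_eq_of_lt i.2]
    have hrank : rank (Set.range I.id) (I.id x) = j * Y + i.1 := hx
    have h1 : name (Set.range I.id) (j * Y + i.1) = I.id x := by rw [← hx]; exact I.nth_pos x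
    rw [h1, I.lookup_id]
    have h2 : (f2 I x).2 (I.id v) = some (c (I.pos u)) := by
      simp only [f2, I.lookup_id, hrank, hdiv]
      rw [← hs, hjdef, nth_rank (ids := (s : Set ℕ)) hu]
    simp only [m3, h2, Option.getD_some, hd _ ((I.pos_lt u).trans_le hn)]
    have h3 : name (Set.range I.id) (I.pos u) = I.id u := I.nth_pos u
    have h4 : ((f2 I x).1.2 (I.id u)) = some (e (f I u) i) := by
      simp only [f2, f1, I.lookup_id, hrank, hmod]
    rw [h3, h4, Option.getD_some]
  change Function.invFunOn e {a | ∃ I v, f I v = a} _ = _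
  rw [hrec]
  exact he.leftInvOn_invFunOn ⟨I, u, rfl⟩

/-- Every vertex learns the views in a ball whose radius is larger by one. -/
theorem know_succ {k Y : ℕ}
    (hf : Learnable b R fun I : NetworkInstance n idBits Δstar ρ ℓin => I.know k) (hn : n ≤ 2 ^ b)
    (hY : 0 < Y) (hw : (Δstar + 1) ^ k * (viewBits n idBits Δstar ℓin + 1) ≤ Y * b)
    (hYn : Y * min Δstar n ≤ n) :
    Learnable b (R + 3) fun I : NetworkInstance n idBits Δstar ρ ℓin => I.know (k + 1) := by
  classical
  obtain ⟨h, hL, hh⟩ := hf.read hn (codable_know n idBits Δstar ρ ℓin k) hw hYn hY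
    (fun a ids => a.nstarIds.image (rank ids)) (by
      intro I v
      refine Finset.card_image_le.trans (Finset.card_image_le.trans (le_min (I.card_nstar_le v) ?_))
      exact (Finset.card_le_univ _).trans_eq (Fintype.card_fin n))
  refine hL.map (fun a ids y => {a} ∪ a.nstarIds.biUnion fun x => y.2 (rank ids x))
    fun I v => ?_
  have key : ∀ u ∈ I.nstar v, h I v (rank (Set.range I.id) (I.id u)) = I.know k u := by
    intro u hu
    exact hh I v u (Finset.mem_image_of_mem _ (Finset.mem_image_of_mem _ hu))
  ext a
  simp only [NetworkInstance.mem_know, NetworkInstance.mem_ball_succ, Finset.mem_union,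
    Finset.mem_singleton, Finset.mem_biUnion]
  constructor
  · rintro ⟨x, rfl | ⟨u, hu, hx⟩, rfl⟩
    · exact Or.inl rfl
    · refine Or.inr ⟨I.id u, Finset.mem_image_of_mem _ hu, ?_⟩
      rw [key u hu]
      exact NetworkInstance.mem_know.2 ⟨x, hx, rfl⟩
  · rintro (rfl | ⟨y, hy, ha⟩)
    · exact ⟨v, Or.inl rfl, rfl⟩
    · obtain ⟨u, hu, rfl⟩ := Finset.mem_image.1 hy
      rw [key u hu, NetworkInstance.mem_know] at ha
      obtain ⟨x, hx, rfl⟩ := ha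
      exact ⟨x, Or.inr ⟨u, hu, hx⟩, rfl⟩

theorem know_zero :
    Learnable b 1 fun I : NetworkInstance n idBits Δstar ρ ℓin => I.know 0 :=
  one.map (fun a _ _ => {a}) fun I v => by simp [NetworkInstance.know, NetworkInstance.ball]

theorem know {k Y : ℕ} (hn : n ≤ 2 ^ b) (hY : 0 < Y)
    (hw : (Δstar + 1) ^ (k - 1) * (viewBits n idBits Δstar ℓin + 1) ≤ Y * b)
    (hYn : Y * min Δstar n ≤ n) :
    Learnable b (1 + 3 * k) fun I : NetworkInstance n idBits Δstar ρ ℓin => I.know k := by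
  suffices h : ∀ i ≤ k, Learnable b (1 + 3 * i)
      fun I : NetworkInstance n idBits Δstar ρ ℓin => I.know i from h k le_rfl
  intro i
  induction i with
  | zero => intro _; exact know_zero
  | succ i ih =>
    intro hi
    refine (ih (by omega)).know_succ hn hY (le_trans ?_ hw) hYn
    exact Nat.mul_le_mul_right _ (Nat.pow_le_pow_right (by omega) (by omega))

theorem exists_algorithm_of_know {k : ℕ}
    (hf : Learnable b R fun I : NetworkInstance n idBits Δstar ρ ℓin => I.know k)
    (A : LocalAlgorithm) (τ : ℕ)
    (hball : ∀ (I : NetworkInstance n idBits Δstar ρ ℓin) v, I.ball τ v ⊆ I.ball k v) :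
    ∃ S : CliqueAlgorithm b, ∀ I : NetworkInstance n idBits Δstar ρ ℓin,
      A.OnlyReceivesFromNstar I τ → ∀ coins v,
        S.outputAfter I coins R v = A.outputAfter I τ v := by
  obtain ⟨S, hS⟩ := (hf.map (f' := fun I v => A.output (A.simState (I.know k v) τ (I.id v)))
    (fun a _ W => A.output (A.simState W τ a.id)) fun I v => rfl).exists_algorithm
  refine ⟨S, fun I hA coins v => ?_⟩
  rw [hS, LocalAlgorithm.outputAfter, A.simState_eq I _ τ hA]
  · intro u hu
    exact NetworkInstance.mem_know.2 ⟨u, hball I v hu, rfl⟩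
  · intro a ha
    obtain ⟨u, -, hu⟩ := NetworkInstance.mem_know.1 ha
    exact ⟨u, hu⟩

open Classical in
/-- The vertex of rank `p` reads what the vertices with ranks in `F p` know, and sends the outputs
that it can determine to the respective vertices. -/
theorem exists_algorithm_of_covering {r s m Y ℓout : ℕ}
    (hf : Learnable b R fun I : NetworkInstance n idBits Δstar ρ ℓin => I.know r)
    (A : LocalAlgorithm) (hn : n ≤ 2 ^ b) (hY : 0 < Y)
    (hw : (Δstar + 1) ^ r * (viewBits n idBits Δstar ℓin + 1) ≤ Y * b) (hout : ℓout * 2 + 1 ≤ b)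
    (F : Fin n → Finset (Fin n)) (hF : ∀ p, (F p).card * Y ≤ n)
    (hcover : ∀ B : Finset (Fin n), B.card ≤ m → ∃ p, B ⊆ F p)
    (hball : ∀ (I : NetworkInstance n idBits Δstar ρ ℓin) v, (I.ball s v).card ≤ m) :
    ∃ S : CliqueAlgorithm b, ∀ I : NetworkInstance n idBits Δstar ρ ℓin,
      A.OnlyReceivesFromNstar I (s + r) → (∀ v, (A.outputAfter I (s + r) v).length ≤ ℓout) →
      ∀ coins v, S.outputAfter I coins (R + 4) v = A.outputAfter I (s + r) v := by
  -- The family is applied to ranks, so it does not depend on the instance and all vertices know it.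
  let F' (p : ℕ) : Finset ℕ := if h : p < n then (F ⟨p, h⟩).image Fin.val else ∅
  have hF' : ∀ p, (F' p).card ≤ n / Y := by
    intro p
    rw [Nat.le_div_iff_mul_le hY]
    simp only [F']
    split_ifs with h
    · exact (Nat.mul_le_mul_right _ Finset.card_image_le).trans (hF _)
    · simp
  obtain ⟨h, hL, hh⟩ := hf.read hn (codable_know n idBits Δstar ρ ℓin r) hw
    (Nat.mul_div_le n Y) hY (fun a ids => F' (rank ids a.id)) fun I v => hF' _
  -- Two bits per possible output symbol, and one to say that no output was determined.
  obtain ⟨e, he⟩ := ((Codable.bool.list ℓout).option.mono hout)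
  let d := Function.invFunOn e {o : Option (List Bool) | ∀ l ∈ o, l ∈
    {l : List Bool | l.length ≤ ℓout ∧ ∀ a ∈ l, a ∈ Set.univ}}
  let W (p : ℕ) (y : ℕ → Finset LocalView) : Set LocalView := {a | ∃ q ∈ F' p, a ∈ y q}
  let o (W : Set LocalView) (x : ℕ) : Option (List Bool) :=
    if LocalAlgorithm.Determines W (s + r) x then some (A.output (A.simState W (s + r) x)) else none
  have hL' := hL.exchange fun a ids y x => e (o (W (rank ids a.id) y.2) x)
  -- Any choice will do: by `ho` below, every output that is sent is the correct one.
  let pick (L : ℕ → Option (Fin b → Bool)) : List Bool :=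
    if hx : ∃ l x z, L x = some z ∧ d z = some l then hx.choose else []
  obtain ⟨S, hS⟩ := (hL'.map (f' := fun I v => pick (I.lookup fun u =>
    e (o (W (I.pos u) (h I u)) (I.id v)))) (fun _ _ y => pick y.2) fun I v => rfl).exists_algorithm
  refine ⟨S, fun I hA hlen coins v => ?_⟩
  rw [hS]
  have hWeq : ∀ u, W (I.pos u) (h I u) = {a | ∃ x, I.pos x ∈ F' (I.pos u) ∧ a ∈ I.know r x} := by
    intro u
    ext a
    constructor
    · rintro ⟨q, hq, ha⟩
      have hqn : q < n := by
        simp only [F', dif_pos (I.pos_lt u), Finset.mem_image] at hq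
        obtain ⟨p, -, rfl⟩ := hq
        exact p.2
      obtain ⟨x, rfl⟩ := I.exists_pos_eq hqn
      rw [hh I u x hq] at ha
      exact ⟨x, hq, ha⟩
    · rintro ⟨x, hx, ha⟩
      refine ⟨I.pos x, hx, ?_⟩
      rwa [hh I u x hx]
  have hWsub : ∀ u, W (I.pos u) (h I u) ⊆ Set.range I.localView := by
    intro u a ha
    rw [hWeq] at ha
    obtain ⟨x, -, ha⟩ := ha
    obtain ⟨y, -, rfl⟩ := NetworkInstance.mem_know.1 ha
    exact ⟨y, rfl⟩
  have ho : ∀ u, ∀ l ∈ o (W (I.pos u) (h I u)) (I.id v), l = A.outputAfter I (s + r) v := by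
    intro u l hl
    simp only [o] at hl
    split_ifs at hl with hdet
    · rw [LocalAlgorithm.determines_iff I (hWsub u)] at hdet
      rw [Option.mem_some_iff, A.simState_eq I (hWsub u) _ hA v hdet] at hl
      exact hl.symm
    · cases hl
  have hd : ∀ u, d (e (o (W (I.pos u) (h I u)) (I.id v))) = o (W (I.pos u) (h I u)) (I.id v) := by
    intro u
    refine he.leftInvOn_invFunOn fun l hl => ⟨?_, fun _ _ => trivial⟩
    rw [ho u l hl]
    exact hlen v
  have hex : ∃ l x z, (I.lookup fun u => e (o (W (I.pos u) (h I u)) (I.id v))) x = some z ∧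
      d z = some l := by
    obtain ⟨p, hp⟩ := hcover ((I.ball s v).image fun u => ⟨I.pos u, I.pos_lt u⟩)
      (Finset.card_image_le.trans (hball I v))
    obtain ⟨u, hu⟩ := I.exists_pos_eq p.2
    have hdet : LocalAlgorithm.Determines (W (I.pos u) (h I u)) (s + r) (I.id v) := by
      rw [LocalAlgorithm.determines_iff I (hWsub u)]
      intro x hx
      obtain ⟨y, hy, hxy⟩ := I.ball_subset_add s r v x hx
      rw [hWeq]
      refine ⟨y, ?_, NetworkInstance.mem_know.2 ⟨x, hxy, rfl⟩⟩
      have hmem := hp (Finset.mem_image_of_mem _ hy)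
      simp only [F', hu, dif_pos p.2]
      exact Finset.mem_image.2 ⟨_, hmem, rfl⟩
    exact ⟨A.output (A.simState (W (I.pos u) (h I u)) (s + r) (I.id v)), I.id u, _,
      I.lookup_id _ u, (hd u).trans (if_pos hdet)⟩
  simp only [pick]
  rw [dif_pos hex]
  obtain ⟨x, z, h1, h2⟩ := hex.choose_spec
  obtain ⟨u, -, rfl⟩ := NetworkInstance.lookup_eq_some h1
  rw [hd u] at h2
  exact ho u _ h2

end Learnable

end Simulation

/-! ### Covering families by the probabilistic method. -/

open Finset in
/-- If every `i` is good for a `1 / D` fraction of `Ω` then some `T` elements of `Ω` serve all `i`. -/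
theorem exists_tuple_forall_exists_good {Ω ι : Type} [Fintype Ω] [Fintype ι] (good : ι → Ω → Prop)
    (D T : ℕ) (hD : 0 < D) [∀ i, DecidablePred (good i)]
    (hgood : ∀ i, Fintype.card Ω ≤ D * #{ω | good i ω})
    (hΩ : 0 < Fintype.card Ω)
    (hT : (Fintype.card ι : ℝ) * (1 - 1 / (D : ℝ)) ^ T < 1) :
    ∃ f : Fin T → Ω, ∀ i, ∃ t, good i (f t) := by
  classical
  by_contra! hcon
  have hcover : (univ : Finset (Fin T → Ω)) ⊆ univ.biUnion fun i : ι =>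
      Fintype.piFinset fun _ : Fin T => ({ω | ¬ good i ω} : Finset Ω) := by
    intro f _
    obtain ⟨i, hi⟩ := hcon f
    simp only [mem_biUnion, mem_univ, true_and, Fintype.mem_piFinset, mem_filter]
    exact ⟨i, hi⟩
  have h1 : (Fintype.card Ω : ℝ) ^ T ≤
      ∑ i : ι, ((#{ω | ¬ good i ω} : ℕ) : ℝ) ^ T := by
    have := (card_le_card hcover).trans card_biUnion_le
    simp only [card_univ, Fintype.card_pi, prod_const, Fintype.card_fin, Fintype.card_piFinset]
      at this
    exact_mod_cast this
  have hN : (0 : ℝ) < Fintype.card Ω := by exact_mod_cast hΩ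
  have hD' : (0 : ℝ) < D := by exact_mod_cast hD
  have h2 : ∀ i, ((#{ω | ¬ good i ω} : ℕ) : ℝ) ≤ Fintype.card Ω * (1 - 1 / (D : ℝ)) := by
    intro i
    have h3 : (#{ω | good i ω} : ℝ) + #{ω | ¬ good i ω} = Fintype.card Ω := by
      exact_mod_cast card_filter_add_card_filter_not (s := (univ : Finset Ω)) (good i)
    have h4 : (Fintype.card Ω : ℝ) ≤ D * #{ω | good i ω} := by exact_mod_cast hgood i
    have h5 : (Fintype.card Ω : ℝ) / D ≤ #{ω | good i ω} := by
      rw [div_le_iff₀ hD']; linarith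
    rw [mul_sub, mul_one, mul_one_div]
    linarith
  have h6 : (Fintype.card Ω : ℝ) ^ T ≤
      Fintype.card ι * (Fintype.card Ω * (1 - 1 / (D : ℝ))) ^ T := by
    refine h1.trans ((sum_le_sum fun i _ => pow_le_pow_left₀ (by positivity) (h2 i) T).trans ?_)
    simp
  rw [mul_pow] at h6
  have : (0 : ℝ) < (Fintype.card Ω : ℝ) ^ T := by positivity
  nlinarith

open Finset in
theorem card_filter_forall_eq_zero_mul_pow {n q : ℕ} [NeZero q] (B : Finset (Fin n)) :
    #{ω : Fin n → Fin q | ∀ v ∈ B, ω v = 0} * q ^ #B = q ^ n := by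
  classical
  have h : ({ω : Fin n → Fin q | ∀ v ∈ B, ω v = 0} : Finset (Fin n → Fin q)) =
      Fintype.piFinset fun v => if v ∈ B then {0} else univ := by
    ext ω
    simp only [mem_filter, mem_univ, true_and, Fintype.mem_piFinset]
    refine forall_congr' fun v => ?_
    by_cases hv : v ∈ B <;> simp [hv]
  have h2 : q ^ #B = ∏ v : Fin n, if v ∈ B then q else 1 := by
    rw [prod_ite_mem, univ_inter, prod_const]
  rw [h, Fintype.card_piFinset, h2, ← prod_mul_distrib]
  rw [prod_congr rfl (g := fun _ => q), prod_const, card_univ, Fintype.card_fin]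
  intro v _
  by_cases hv : v ∈ B <;> simp [hv]

open Finset in
/-- A `1 / (2 q ^ #B)` fraction of the colourings has a zero set that contains `B` and has at most
`n / Y` elements. -/
theorem pow_le_mul_card_filter_subset {n q Y m : ℕ} [NeZero q] (hq : q = 4 * Y) (B : Finset (Fin n))
    (hB : #B ≤ m) (hm : 4 * (m * Y) ≤ n) :
    q ^ n ≤ 2 * q ^ m *
      #{ω : Fin n → Fin q | B ⊆ univ.filter (fun v => ω v = 0) ∧
        #(univ.filter (fun v => ω v = 0)) * Y ≤ n} := by
  classical
  set G : Finset (Fin n → Fin q) := {ω | ∀ v ∈ B, ω v = 0} with hG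
  have hq0 : 0 < q := Nat.pos_of_ne_zero (NeZero.ne q)
  have hcard : #G * q ^ #B = q ^ n := card_filter_forall_eq_zero_mul_pow B
  -- Given that `B` is coloured zero, the expected size of the zero set is at most `m + n / q`:
  -- every vertex outside `B` is still zero with probability `1 / q`.
  have hsum : q * ∑ ω ∈ G, #(univ.filter (fun v => ω v = 0)) ≤ #G * (q * m + n) := by
    have h1 : ∑ ω ∈ G, #(univ.filter (fun v => ω v = 0)) =
        ∑ v : Fin n, #(G.filter (fun ω => ω v = 0)) := by
      simp only [card_filter]
      exact sum_comm
    have h2 : ∀ v, q * #(G.filter (fun ω => ω v = 0)) ≤ (if v ∈ B then q * #G else 0) + #G := by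
      intro v
      by_cases hv : v ∈ B
      · rw [if_pos hv]
        have := card_filter_le G (fun ω => ω v = 0)
        nlinarith
      · rw [if_neg hv, zero_add]
        have h3 : G.filter (fun ω => ω v = 0) = 
            ({ω | ∀ u ∈ insert v B, ω u = 0} : Finset (Fin n → Fin q)) := by
          ext ω
          simp [hG, and_comm]
        have h4 := card_filter_forall_eq_zero_mul_pow (q := q) (insert v B)
        rw [card_insert_of_notMem hv, ← hcard, ← h3, pow_succ', ← mul_assoc] at h4
        have h5 := Nat.eq_of_mul_eq_mul_right (by positivity) h4
        rw [mul_comm]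
        exact h5.le
    rw [h1, mul_sum]
    refine (sum_le_sum fun v _ => h2 v).trans ?_
    rw [sum_add_distrib, sum_ite_mem, univ_inter, sum_const, sum_const, card_univ,
      Fintype.card_fin, smul_eq_mul, smul_eq_mul]
    nlinarith [Nat.mul_le_mul_right (q * #G) hB]
  set H : Finset (Fin n → Fin q) := {ω | B ⊆ univ.filter (fun v => ω v = 0) ∧
        #(univ.filter (fun v => ω v = 0)) * Y ≤ n} with hH
  have hHG : H = G.filter (fun ω => #(univ.filter (fun v => ω v = 0)) * Y ≤ n) := by
    ext ω
    simp [hH, hG, subset_iff]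
  set H' : Finset (Fin n → Fin q) :=
    G.filter (fun ω => ¬ #(univ.filter (fun v => ω v = 0)) * Y ≤ n) with hH'
  have hadd : #H + #H' = #G := by
    rw [hHG]
    exact card_filter_add_card_filter_not _
  -- Markov's inequality; `H'` collects the zero sets that are too large.
  have hbad : (n + 1) * #H' ≤ Y * ∑ ω ∈ G, #(univ.filter (fun v => ω v = 0)) := by
    rw [mul_sum]
    calc (n + 1) * #H' = ∑ ω ∈ H', (n + 1) := by rw [sum_const, smul_eq_mul, mul_comm]
      _ ≤ ∑ ω ∈ H', Y * #(univ.filter (fun v => ω v = 0)) := by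
          refine sum_le_sum fun ω hω => ?_
          have := (mem_filter.1 hω).2
          rw [mul_comm Y]
          omega
      _ ≤ _ := sum_le_sum_of_subset (filter_subset _ _)
  have hY : 4 * ((n + 1) * #H') ≤ #G * (q * m + n) := by
    refine le_trans ?_ hsum
    calc 4 * ((n + 1) * #H') ≤ 4 * (Y * ∑ ω ∈ G, #(univ.filter (fun v => ω v = 0))) :=
          Nat.mul_le_mul_left _ hbad
      _ = 4 * Y * ∑ ω ∈ G, #(univ.filter (fun v => ω v = 0)) := by ring
      _ ≤ _ := Nat.mul_le_mul_right _ hq.ge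
  have hqm : q * m ≤ n := by nlinarith
  have h2 : 2 * #H' ≤ #G := by
    have : #G * (q * m + n) ≤ #G * (2 * n) := Nat.mul_le_mul_left _ (by omega)
    by_contra hlt
    push Not at hlt
    nlinarith [Nat.mul_le_mul_right (n + 1) hlt]
  have hG2 : #G ≤ 2 * #H := by omega
  calc q ^ n = #G * q ^ #B := hcard.symm
    _ ≤ (2 * #H) * q ^ m := Nat.mul_le_mul hG2 (Nat.pow_le_pow_right hq0 hB)
    _ = _ := by ring

open Finset in
/-- A family of `n` sets of size at most `n / Y` that covers all sets of at most `m` elements. -/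
theorem exists_covering_family {n Y m : ℕ} (hY : 0 < Y) (hm0 : 0 < m) (hm : 4 * (m * Y) ≤ n)
    (h : (m : ℝ) * Real.log n * (2 * (4 * Y) ^ m) < n) :
    ∃ F : Fin n → Finset (Fin n), (∀ p, #(F p) * Y ≤ n) ∧
      ∀ B : Finset (Fin n), #B ≤ m → ∃ p, B ⊆ F p := by
  classical
  have hn : 0 < n := by nlinarith
  have : NeZero (4 * Y) := ⟨by omega⟩
  set D : ℕ := 2 * (4 * Y) ^ m with hD
  have hD0 : 0 < D := by positivity
  -- Tuples replace sets of at most `m` elements, so that the union bound runs over exactly `n ^ m`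
  -- events.
  let good (g : Fin m → Fin n) (ω : Fin n → Fin (4 * Y)) : Prop :=
    univ.image g ⊆ univ.filter (fun v => ω v = 0) ∧ #(univ.filter (fun v => ω v = 0)) * Y ≤ n
  obtain ⟨f, hf⟩ := exists_tuple_forall_exists_good good D n hD0 (by
    intro g
    have := pow_le_mul_card_filter_subset (q := 4 * Y) rfl (univ.image g)
      (card_image_le.trans (by simp)) hm
    simpa [good] using this) Fintype.card_pos (by
    have hD' : (0 : ℝ) < D := by exact_mod_cast hD0
    have h1 : (1 : ℝ) - 1 / D ≤ Real.exp (-(1 / D)) := by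
      have := Real.add_one_le_exp (-(1 / (D : ℝ)))
      linarith
    have hD1 : (1 : ℝ) ≤ D := by exact_mod_cast hD0
    have h2 : (0 : ℝ) ≤ 1 - 1 / D := by
      rw [sub_nonneg, div_le_one hD']; exact hD1
    have h3 : ((Fintype.card (Fin m → Fin n) : ℕ) : ℝ) = Real.exp (m * Real.log n) := by
      rw [Fintype.card_pi_const, Fintype.card_fin, Nat.cast_pow, Real.exp_nat_mul, Real.exp_log]
      exact_mod_cast hn
    have h4 : (m : ℝ) * Real.log n < n / D := by
      rw [lt_div_iff₀ hD', hD]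
      push_cast
      exact h
    calc ((Fintype.card (Fin m → Fin n) : ℕ) : ℝ) * (1 - 1 / (D : ℝ)) ^ n
        ≤ Real.exp (m * Real.log n) * Real.exp (-(1 / D)) ^ n := by rw [h3]; gcongr
      _ = Real.exp (m * Real.log n - n / D) := by
          rw [← Real.exp_nat_mul, ← Real.exp_add]; congr 1; ring
      _ < 1 := by rw [Real.exp_lt_one_iff]; linarith)
  -- Oversized zero sets are discarded; goodness includes the size bound, so they are never needed.
  refine ⟨fun p => if #(univ.filter (fun v => f p v = 0)) * Y ≤ n then
    univ.filter (fun v => f p v = 0) else ∅, fun p => ?_, fun B hB => ?_⟩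
  · dsimp only
    split_ifs with hp
    · exact hp
    · simp
  · have hex : ∃ g : Fin m → Fin n, B ⊆ univ.image g := by
      let l := B.toList
      refine ⟨fun i => l.getD i ⟨0, hn⟩, fun x hx => ?_⟩
      obtain ⟨i, hi, rfl⟩ := List.getElem_of_mem (mem_toList.2 hx)
      refine mem_image.2 ⟨⟨i, ?_⟩, mem_univ _, ?_⟩
      · rw [length_toList] at hi; omega
      · simp only [l]
        exact List.getD_eq_getElem _ _ hi
    obtain ⟨g, hg⟩ := hex
    obtain ⟨p, hp⟩ := hf g
    refine ⟨p, ?_⟩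
    dsimp only
    rw [if_pos hp.2]
    exact hg.trans hp.1

/-! ### Numerical estimates. -/

theorem exists_mul_add_le_two_pow (C : ℕ) : ∃ r, C ≤ r ∧ 8 * C * (r + 4) ≤ 2 ^ r := by
  have h : ∀ t, 4 ≤ t → 2 * t + 4 ≤ 2 ^ t := fun t ht => by
    induction t, ht using Nat.le_induction with
    | base => norm_num
    | succ t _ ih => rw [pow_succ]; omega
  -- One half of the exponent pays for `8 * C`, the other for `r + 4`.
  refine ⟨2 * (8 * C + 4), by omega, ?_⟩
  rw [two_mul, pow_add]
  have h1 := h (8 * C + 4) (by omega)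
  exact Nat.mul_le_mul (by omega) (by omega)

/-- Rounding `N / b` up costs a factor of at most two when `N > b`. Otherwise `Y = 1`, and the
minimum is needed since `Δ` may exceed `n`. -/
theorem exists_chunk_number {N Δ b n : ℕ} (hb : 0 < b) (h : 2 * (N * Δ) ≤ b * n) :
    ∃ Y, 0 < Y ∧ N ≤ Y * b ∧ Y * min Δ n ≤ n := by
  by_cases hN : N ≤ b
  · exact ⟨1, one_pos, by omega, by simp⟩
  · refine ⟨N / b + 1, Nat.succ_pos _, ?_, ?_⟩
    · rw [mul_comm]
      exact (Nat.lt_mul_div_succ N hb).le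
    · refine (Nat.mul_le_mul_left _ (min_le_left _ _)).trans ?_
      have h1 : b * (N / b) ≤ N := Nat.mul_div_le N b
      refine Nat.le_of_mul_le_mul_left ?_ hb
      calc b * ((N / b + 1) * Δ) = (b * (N / b) + b) * Δ := by ring
        _ ≤ (2 * N) * Δ := Nat.mul_le_mul_right _ (by omega)
        _ ≤ b * n := by rw [mul_assoc]; exact h

theorem one_le_logb_two {n : ℕ} (hn : 2 ≤ n) : 1 ≤ Real.logb 2 n := by
  rw [Real.le_logb_iff_rpow_le one_lt_two (by exact_mod_cast (by omega : 0 < n)), Real.rpow_one]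
  exact_mod_cast hn

theorem logb_two_le_clog {n : ℕ} (hn : 2 ≤ n) : Real.logb 2 n ≤ Nat.clog 2 n := by
  rw [Real.logb_le_iff_le_rpow one_lt_two (by exact_mod_cast (by omega : 0 < n)),
    Real.rpow_natCast]
  exact_mod_cast Nat.le_pow_clog one_lt_two n

theorem logb_two_le_two_mul_log {x : ℝ} (hx : 1 ≤ x) : Real.logb 2 x ≤ 2 * Real.log x := by
  have h2 := Real.log_two_gt_d9
  have h0 := Real.log_nonneg hx
  rw [Real.logb, div_le_iff₀ (by linarith)]
  nlinarith

theorem viewBits_succ_le {n idBits Δstar ℓin C : ℕ} (hn : 2 ≤ n) (hΔ : 1 ≤ Δstar)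
    (hid : (idBits : ℝ) ≤ C * Real.logb 2 n) :
    (viewBits n idBits Δstar ℓin : ℝ) + 1 ≤
      (2 * C + 6) * Nat.clog 2 n * (Δstar + ℓin / Real.logb 2 n) := by
  have hL := one_le_logb_two hn
  have hℓ := logb_two_le_clog hn
  set L := Real.logb 2 n
  set ℓ := Nat.clog 2 n
  have hx : (ℓin : ℝ) = ℓin / L * L := by field_simp
  have hx0 : 0 ≤ (ℓin : ℝ) / L := by positivity
  have hΔ' : (1 : ℝ) ≤ Δstar := by exact_mod_cast hΔ
  have hid' : (idBits : ℝ) ≤ C * ℓ := hid.trans (by gcongr)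
  have h1 : (ℓin : ℝ) ≤ ℓin / L * ℓ := hx.le.trans (by gcongr)
  set x := (ℓin : ℝ) / L
  have hC : (0 : ℝ) ≤ C := by positivity
  have hℓ1 : (1 : ℝ) ≤ ℓ := hL.trans hℓ
  have h2 : (ℓ : ℝ) ≤ Δstar * ℓ := by nlinarith
  have h3 : (1 : ℝ) ≤ Δstar * ℓ := hℓ1.trans h2
  have h4 : (C * ℓ : ℝ) ≤ C * (Δstar * ℓ) := by gcongr
  have h5 : (Δstar : ℝ) * (idBits + 1) ≤ Δstar * (C * ℓ + ℓ) := by gcongr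
  have h6 : 4 * (x * ℓ) ≤ (2 * C + 6) * (x * ℓ) := by
    have : 0 ≤ x * ℓ := by positivity
    nlinarith [mul_nonneg hC this]
  simp only [viewBits]
  push_cast
  nlinarith

/-- If `Δstar ^ τ ≤ 2 * C`, the bound on `ℓin` suffices. Otherwise the hypothesis forces `log X ≤
(log n) / 2`, so `X ≤ √n`, while `Δstar ^ τ ≤ C * log n = O(√n)`. -/
theorem pow_mul_le_of_mul_logb_le {n τ Δstar ℓin C : ℕ} (hn : 2 ≤ n) (hΔ : 1 ≤ Δstar) (hτ : 1 ≤ τ)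
    (hC : 1 ≤ C)
    (h : (Δstar : ℝ) ^ τ * Real.logb 2 (Δstar + ℓin / Real.logb 2 n) ≤ C * Real.logb 2 n)
    (hin : (ℓin : ℝ) ≤ C * n) :
    (Δstar : ℝ) ^ τ * (Δstar + ℓin / Real.logb 2 n) ≤ 6 * C ^ 2 * n := by
  have hL := one_le_logb_two hn
  have hn' : (2 : ℝ) ≤ n := by exact_mod_cast hn
  have hC' : (1 : ℝ) ≤ C := by exact_mod_cast hC
  have hΔ' : (1 : ℝ) ≤ Δstar := by exact_mod_cast hΔ
  have hx0 : 0 ≤ (ℓin : ℝ) / Real.logb 2 n := by positivity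
  have hM : (Δstar : ℝ) ≤ Δstar ^ τ := le_self_pow₀ hΔ' (by omega)
  set L := Real.logb 2 n with hLdef
  set M : ℝ := (Δstar : ℝ) ^ τ with hMdef
  have hM0 : 0 < M := by linarith
  by_cases hcase : M ≤ 2 * C
  · have h1 : (ℓin : ℝ) / L ≤ C * n := (div_le_self (by positivity) hL).trans hin
    have h2 : (Δstar : ℝ) + ℓin / L ≤ 3 * (C * n) := by nlinarith
    calc M * (Δstar + ℓin / L) ≤ (2 * C) * (3 * (C * n)) := by gcongr
      _ = _ := by ring
  · push Not at hcase
    have hΔ2 : 2 ≤ Δstar := by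
      by_contra hlt
      have : Δstar = 1 := by omega
      rw [hMdef, this] at hcase
      norm_num at hcase
      linarith
    have hX : (2 : ℝ) ≤ Δstar + ℓin / L := by
      have : (2 : ℝ) ≤ Δstar := by exact_mod_cast hΔ2
      linarith
    set X := (Δstar : ℝ) + ℓin / L
    have hX1 : 1 ≤ Real.logb 2 X := by
      rw [Real.le_logb_iff_rpow_le one_lt_two (by linarith), Real.rpow_one]; exact hX
    have hlog : 2 * Real.logb 2 X ≤ L := by
      by_contra hlt
      push Not at hlt
      nlinarith
    have hs0 : 0 < √(n : ℝ) := Real.sqrt_pos.2 (by linarith)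
    have hss : √(n : ℝ) * √(n : ℝ) = n := Real.mul_self_sqrt (by linarith)
    have hLs : L = 2 * Real.logb 2 √(n : ℝ) := by
      rw [hLdef, ← hss, Real.logb_mul hs0.ne' hs0.ne', Real.sqrt_mul_self hs0.le]; ring
    have hXs : X ≤ √(n : ℝ) := by
      rw [← Real.logb_le_logb one_lt_two (by linarith) hs0]
      linarith
    have hMs : M ≤ C * (4 * √(n : ℝ)) := by
      have h1 : M ≤ C * L := by nlinarith
      refine h1.trans ?_
      gcongr
      have h2 := logb_two_le_two_mul_log (x := √(n : ℝ)) (Real.one_le_sqrt.2 (by linarith))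
      have h3 := Real.log_le_sub_one_of_pos hs0
      linarith
    calc M * X ≤ (C * (4 * √(n : ℝ))) * √(n : ℝ) := by gcongr
      _ = 4 * C * n := by linear_combination 4 * (C : ℝ) * hss
      _ ≤ 6 * C ^ 2 * n := by gcongr <;> nlinarith

/-- Since `m * Δstar ^ r = 2 * Δstar ^ τ` and `Δstar ^ r ≥ 2 ^ r`, the choice of `r` gives `(r + 4)
* m * log X ≤ (log n) / 4`. With `4 * Y ≤ X ^ (r + 4)` this yields `(4 * Y) ^ m ≤ n ^ (1/4)`. -/
theorem covering_parameters {n τ Δstar ℓin C r : ℕ} (hn : 2 ≤ n) (hΔ : 2 ≤ Δstar) (hC : 1 ≤ C)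
    (hr : 8 * C * (r + 4) ≤ 2 ^ r) (hτ : r < τ)
    (h : (Δstar : ℝ) ^ τ * Real.logb 2 (Δstar + ℓin / Real.logb 2 n) ≤ C * Real.logb 2 n) :
    ∃ Y : ℕ, 0 < Y ∧ (Δstar : ℝ) ^ r * (Δstar + ℓin / Real.logb 2 n) ≤ Y ∧ Y * Δstar ≤ n ∧
      4 * (2 * Δstar ^ (τ - r) * Y) ≤ n ∧
      ((2 * Δstar ^ (τ - r) : ℕ) : ℝ) * Real.log n * (2 * (4 * Y) ^ (2 * Δstar ^ (τ - r))) < n := by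
  have hL := one_le_logb_two hn
  have hn' : (2 : ℝ) ≤ n := by exact_mod_cast hn
  have hC' : (1 : ℝ) ≤ C := by exact_mod_cast hC
  have hΔ' : (2 : ℝ) ≤ Δstar := by exact_mod_cast hΔ
  have hx0 : 0 ≤ (ℓin : ℝ) / Real.logb 2 n := by positivity
  have hr' : 8 * (C : ℝ) * (r + 4) ≤ 2 ^ r := by exact_mod_cast hr
  set L := Real.logb 2 n with hLdef
  set X : ℝ := (Δstar : ℝ) + ℓin / L with hXdef
  set m : ℕ := 2 * Δstar ^ (τ - r) with hm
  have hX : 2 ≤ X := by linarith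
  have hX1 : 1 ≤ Real.logb 2 X := by
    rw [Real.le_logb_iff_rpow_le one_lt_two (by linarith), Real.rpow_one]; exact hX
  have hr0 : (0 : ℝ) ≤ r := by positivity
  have hΔr : (2 : ℝ) ^ r ≤ (Δstar : ℝ) ^ r := by gcongr
  have hΔr1 : (1 : ℝ) ≤ (Δstar : ℝ) ^ r := one_le_pow₀ (by linarith)
  have hmM : (m : ℝ) * (Δstar : ℝ) ^ r = 2 * (Δstar : ℝ) ^ τ := by
    rw [hm]; push_cast
    rw [mul_assoc, ← pow_add, Nat.sub_add_cancel hτ.le]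
  have hm1 : 1 ≤ m := by
    have : 1 ≤ Δstar ^ (τ - r) := Nat.one_le_pow _ _ (by omega)
    omega
  have hm1' : (1 : ℝ) ≤ m := by exact_mod_cast hm1
  have hmexp : (r + 4) * (m * Real.logb 2 X) ≤ L / 4 := by
    have h2r : (0 : ℝ) < 2 ^ r := by positivity
    refine le_of_mul_le_mul_left ?_ h2r
    calc (2 : ℝ) ^ r * ((r + 4) * (m * Real.logb 2 X))
        ≤ (Δstar : ℝ) ^ r * ((r + 4) * (m * Real.logb 2 X)) := by gcongr
      _ = (r + 4) * 2 * ((Δstar : ℝ) ^ τ * Real.logb 2 X) := by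
          linear_combination ((r : ℝ) + 4) * Real.logb 2 X * hmM
      _ ≤ (r + 4) * 2 * (C * L) := by gcongr
      _ = (8 * C * (r + 4)) * (L / 4) := by ring
      _ ≤ 2 ^ r * (L / 4) := by gcongr
  have hmL : (m : ℝ) ≤ L := by
    have : (m : ℝ) ≤ m * Real.logb 2 X := by nlinarith
    nlinarith
  have hL64 : 32 ≤ L := by
    have h1 : (2 : ℝ) ^ r ≤ (Δstar : ℝ) ^ τ :=
      hΔr.trans (pow_le_pow_right₀ (by linarith) hτ.le)
    have h2 : (Δstar : ℝ) ^ τ ≤ (Δstar : ℝ) ^ τ * Real.logb 2 X :=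
      le_mul_of_one_le_right (by positivity) hX1
    have h3 : (C : ℝ) * 32 ≤ C * L := by nlinarith
    exact le_of_mul_le_mul_left h3 (by linarith)
  -- With `y = n ^ (1/8) ≥ 16`, the final product is at most `256 * y ^ 4 < y ^ 8`.
  obtain ⟨y, hy0, hy⟩ : ∃ y : ℝ, 0 < y ∧ y ^ 8 = n := by
    refine ⟨(n : ℝ) ^ (1 / 8 : ℝ), by positivity, ?_⟩
    rw [← Real.rpow_natCast, ← Real.rpow_mul (by linarith)]
    norm_num
  have hLy : L = 8 * Real.logb 2 y := by
    rw [hLdef, ← hy, Real.logb_pow]; norm_num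
  have hy4 : 16 ≤ y := by
    have h1 : (4 : ℝ) ≤ Real.logb 2 y := by linarith
    rw [Real.le_logb_iff_rpow_le one_lt_two hy0] at h1
    norm_num at h1
    exact h1
  have hlogn : Real.log n ≤ 8 * y := by
    rw [← hy, Real.log_pow]
    have := Real.log_le_sub_one_of_pos hy0
    push_cast
    linarith
  have hmy : (m : ℝ) ≤ 16 * y := by
    have := logb_two_le_two_mul_log (x := n) (by linarith)
    linarith
  set Y : ℕ := ⌈(Δstar : ℝ) ^ r * X⌉₊ with hY
  have hYge : (Δstar : ℝ) ^ r * X ≤ Y := Nat.le_ceil _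
  have hΔX : 1 ≤ (Δstar : ℝ) ^ r * X := by nlinarith
  have hYle : (Y : ℝ) ≤ 2 * X ^ (r + 1) := by
    have h1 : (Y : ℝ) < (Δstar : ℝ) ^ r * X + 1 := Nat.ceil_lt_add_one (by linarith)
    have h2 : (Δstar : ℝ) ^ r ≤ X ^ r := by gcongr; linarith
    have h3 : (Δstar : ℝ) ^ r * X ≤ X ^ r * X := by gcongr
    rw [pow_succ]
    linarith
  have h4Y : 4 * (Y : ℝ) ≤ X ^ (r + 4) := by
    have h1 : (8 : ℝ) ≤ X ^ 3 := by
      have : (2 : ℝ) ^ 3 ≤ X ^ 3 := by gcongr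
      linarith
    calc 4 * (Y : ℝ) ≤ 8 * X ^ (r + 1) := by linarith
      _ ≤ X ^ 3 * X ^ (r + 1) := by gcongr
      _ = X ^ (r + 4) := by ring
  have hpow : (4 * (Y : ℝ)) ^ m ≤ y ^ 2 := by
    have h1 : (4 * (Y : ℝ)) ^ m ≤ X ^ ((r + 4) * m) := by
      rw [pow_mul X]
      exact pow_le_pow_left₀ (by positivity) h4Y m
    refine h1.trans ?_
    rw [← Real.logb_le_logb one_lt_two (by positivity) (by positivity), Real.logb_pow,
      Real.logb_pow]
    push_cast
    linarith
  have hY1 : (1 : ℝ) ≤ Y := hΔX.trans hYge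
  have hYy : 4 * (Y : ℝ) ≤ y ^ 2 := (le_self_pow₀ (by linarith) (by omega)).trans hpow
  have hyle : ∀ k ≤ 8, y ^ k ≤ n := fun k hk => by
    rw [← hy]; exact pow_le_pow_right₀ (by linarith) hk
  refine ⟨Y, by exact_mod_cast (by linarith : (0 : ℝ) < Y), hYge, ?_, ?_, ?_⟩
  · have h1 : (Δstar : ℝ) ≤ Y := by nlinarith
    have h2 : (Y : ℝ) * Δstar ≤ n := by
      calc (Y : ℝ) * Δstar ≤ (y ^ 2) * (y ^ 2) := by gcongr <;> linarith
        _ = y ^ 4 := by ring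
        _ ≤ n := hyle 4 (by norm_num)
    exact_mod_cast h2
  · have h2 : 4 * ((m : ℝ) * Y) ≤ n := by
      calc 4 * ((m : ℝ) * Y) = m * (4 * Y) := by ring
        _ ≤ (16 * y) * y ^ 2 := by gcongr
        _ ≤ (y * y) * y ^ 2 := by gcongr
        _ = y ^ 4 := by ring
        _ ≤ n := hyle 4 (by norm_num)
    exact_mod_cast h2
  · calc (m : ℝ) * Real.log n * (2 * (4 * Y) ^ m) ≤ (16 * y) * (8 * y) * (2 * y ^ 2) := by
          have := Real.log_nonneg (by linarith : (1 : ℝ) ≤ n)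
          gcongr
      _ = y ^ 4 * 256 := by ring
      _ < y ^ 4 * y ^ 4 := by
          gcongr
          have : (16 : ℝ) ^ 4 ≤ y ^ 4 := by gcongr
          norm_num at this
          linarith
      _ = y ^ 8 := by ring
      _ = n := hy

/-! ### Choice of constants and conclusion. -/

theorem NetworkInstance.nstar_eq_empty {n idBits Δstar ρ ℓin : ℕ} (h : n ≤ 1 ∨ Δstar = 0)
    (I : NetworkInstance n idBits Δstar ρ ℓin) (v : Fin n) : I.nstar v = ∅ := by
  rcases h with h | h
  · refine Finset.eq_empty_of_forall_notMem fun u hu => ?_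
    have huv : u = v := Fin.ext (by omega)
    exact I.graph.loopless.irrefl v (huv ▸ I.adj_of_mem_nstar v u hu)
  · exact Finset.card_eq_zero.1 (Nat.le_zero.1 (h ▸ I.card_nstar_le v))

/-- The simulating algorithm, with a bound on the number of rounds in terms of `C`. -/
theorem exists_simulation (C : ℕ) (hC : 1 ≤ C) : ∃ K : ℕ,
    ∀ n τ Δstar ℓin ℓout ρ idBits : ℕ,
      (Δstar : ℝ) ^ τ * Real.logb 2 (Δstar + ℓin / Real.logb 2 n) ≤ C * Real.logb 2 n →
      (ℓin : ℝ) ≤ C * n → (ℓout : ℝ) ≤ C * Real.logb 2 n → (idBits : ℝ) ≤ C * Real.logb 2 n →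
      (Δstar ≠ 1 ∨ τ ≤ C) → ∀ A : LocalAlgorithm,
        ∃ R : ℕ, R ≤ K ∧ ∃ S : CliqueAlgorithm (K * Nat.clog 2 n),
          ∀ I : NetworkInstance n idBits Δstar ρ ℓin, A.OnlyReceivesFromNstar I τ →
            (∀ v, (A.outputAfter I τ v).length ≤ ℓout) →
            ∀ coins v, S.outputAfter I coins R v = A.outputAfter I τ v := by
  obtain ⟨r, hCr, hr⟩ := exists_mul_add_le_two_pow C
  set K₁ := 2 ^ r * (2 * C + 6) * (6 * C ^ 2) * 2 with hK₁
  -- `K₁` pays for transporting views, `3 * r + 5` bounds the rounds, and `2 * C + 1` suffices to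
  -- encode outputs.
  refine ⟨K₁ + 3 * r + 5 + 2 * C, ?_⟩
  intro n τ Δstar ℓin ℓout ρ idBits h hin hout hid hΔτ A
  set K := K₁ + 3 * r + 5 + 2 * C with hK
  -- All relevant balls are single vertices here; messages may have zero bits when `n ≤ 1`.
  by_cases htriv : (n ≤ 1 ∨ Δstar = 0) ∨ τ = 0
  · obtain ⟨S, hS⟩ := (Learnable.know_zero (n := n) (idBits := idBits) (Δstar := Δstar) (ρ := ρ)
      (ℓin := ℓin) (b := K * Nat.clog 2 n)).exists_algorithm_of_know A τ (by
      intro I v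
      rcases htriv with hE | rfl
      · rw [I.ball_eq_singleton (I.nstar_eq_empty hE), I.ball_eq_singleton (I.nstar_eq_empty hE)]
      · exact subset_rfl)
    exact ⟨1, by omega, S, fun I hA _ => hS I hA⟩
  push Not at htriv
  obtain ⟨⟨hn, hΔ⟩, hτ⟩ := htriv
  have hn2 : 2 ≤ n := hn
  have hΔ1 : 1 ≤ Δstar := Nat.one_le_iff_ne_zero.2 hΔ
  have hℓ : Real.logb 2 n ≤ Nat.clog 2 n := logb_two_le_clog hn2
  have hℓ1 : 1 ≤ Nat.clog 2 n := by exact_mod_cast (one_le_logb_two hn2).trans hℓ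
  have hview := viewBits_succ_le (ℓin := ℓin) hn2 hΔ1 hid
  set ℓ := Nat.clog 2 n
  set V := viewBits n idBits Δstar ℓin
  set X : ℝ := Δstar + ℓin / Real.logb 2 n
  have hX0 : 0 ≤ X := by
    have := one_le_logb_two hn2
    positivity
  have hb : 0 < K * ℓ := by positivity
  have hnb : n ≤ 2 ^ (K * ℓ) :=
    (Nat.le_pow_clog one_lt_two n).trans
      (Nat.pow_le_pow_right two_pos (Nat.le_mul_of_pos_left _ (by omega)))
  have hpow : ∀ k, ((Δstar : ℝ) + 1) ^ k ≤ 2 ^ k * (Δstar : ℝ) ^ k := fun k => by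
    have : (1 : ℝ) ≤ Δstar := by exact_mod_cast hΔ1
    rw [← mul_pow]
    gcongr
    linarith
  by_cases hτr : τ ≤ r
  · have hMX := pow_mul_le_of_mul_logb_le hn2 hΔ1 (Nat.one_le_iff_ne_zero.2 hτ) hC h hin
    obtain ⟨Y, hY, hYw, hYn⟩ := exists_chunk_number (N := (Δstar + 1) ^ (τ - 1) * (V + 1))
      (Δ := Δstar) (n := n) hb (by
        have : 2 * (((Δstar : ℝ) + 1) ^ (τ - 1) * (V + 1) * Δstar) ≤ K * ℓ * n := by
          calc 2 * (((Δstar : ℝ) + 1) ^ (τ - 1) * (V + 1) * Δstar)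
              ≤ 2 * ((2 ^ (τ - 1) * (Δstar : ℝ) ^ (τ - 1)) * ((2 * C + 6) * ℓ * X) * Δstar) := by
                gcongr
                exact hpow _
            _ = 2 ^ (τ - 1) * (2 * C + 6) * 2 * ℓ * ((Δstar : ℝ) ^ (τ - 1 + 1) * X) := by ring
            _ = 2 ^ (τ - 1) * (2 * C + 6) * 2 * ℓ * ((Δstar : ℝ) ^ τ * X) := by
                rw [Nat.sub_add_cancel (Nat.one_le_iff_ne_zero.2 hτ)]
            _ ≤ 2 ^ r * (2 * C + 6) * 2 * ℓ * (6 * C ^ 2 * n) := by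
                gcongr
                · norm_num
                · omega
            _ = (K₁ : ℝ) * ℓ * n := by rw [hK₁]; push_cast; ring
            _ ≤ K * ℓ * n := by
                gcongr
                omega
        exact_mod_cast this)
    obtain ⟨S, hS⟩ := (Learnable.know (ρ := ρ) (k := τ) hnb hY hYw hYn).exists_algorithm_of_know A τ
      fun I v => subset_rfl
    exact ⟨1 + 3 * τ, by omega, S, fun I hA _ => hS I hA⟩
  · push Not at hτr
    -- If `Δstar = 1` then `τ ≤ C ≤ r`, which is excluded in this case.
    have hΔ2 : 2 ≤ Δstar := by omega
    obtain ⟨Y, hY, hXY, hYΔ, hmY, hlog⟩ := covering_parameters hn2 hΔ2 hC hr hτr h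
    have hw : (Δstar + 1) ^ r * (V + 1) ≤ Y * (K * ℓ) := by
      have : ((Δstar : ℝ) + 1) ^ r * (V + 1) ≤ Y * (K * ℓ) := by
        calc ((Δstar : ℝ) + 1) ^ r * (V + 1)
            ≤ (2 ^ r * (Δstar : ℝ) ^ r) * ((2 * C + 6) * ℓ * X) := by
              gcongr
              exact hpow _
          _ = ((Δstar : ℝ) ^ r * X) * ((2 ^ r * (2 * C + 6)) * ℓ) := by ring
          _ ≤ Y * (K * ℓ) := by
              gcongr
              have : 2 ^ r * (2 * C + 6) ≤ K := by
                have h1 : 1 ≤ 6 * C ^ 2 * 2 := by nlinarith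
                have h2 := Nat.le_mul_of_pos_right (2 ^ r * (2 * C + 6)) h1
                have h3 : 2 ^ r * (2 * C + 6) * (6 * C ^ 2 * 2) = K₁ := by rw [hK₁]; ring
                omega
              exact_mod_cast this
      exact_mod_cast this
    have hknow := Learnable.know (ρ := ρ) (k := r) hnb hY
      ((Nat.mul_le_mul_right _ (Nat.pow_le_pow_right (by omega) (Nat.sub_le r 1))).trans hw)
      ((Nat.mul_le_mul_left _ (min_le_left _ _)).trans hYΔ)
    obtain ⟨F, hF, hcover⟩ := exists_covering_family hY (by positivity) hmY hlog
    have hout' : ℓout * 2 + 1 ≤ K * ℓ := by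
      have h1 : ℓout ≤ C * ℓ := by
        have : (ℓout : ℝ) ≤ C * ℓ := hout.trans (by gcongr)
        exact_mod_cast this
      have h2 : (2 * C + 1) * ℓ ≤ K * ℓ := Nat.mul_le_mul_right _ (by omega)
      nlinarith
    obtain ⟨S, hS⟩ := hknow.exists_algorithm_of_covering A hnb hY hw hout' F hF hcover
      fun I => I.card_ball_le_two_mul_pow hΔ2 (τ - r)
    rw [Nat.sub_add_cancel hτr.le] at hS
    exact ⟨1 + 3 * r + 4, by omega, S, hS⟩

theorem mainTheorem7 :
    ∀ (C : ℝ) (c : ℕ), ∃ K : ℕ,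
      ∀ n τ Δstar ℓin ℓout ρ idBits : ℕ,
        (Δstar : ℝ) ^ τ * Real.logb 2 ((Δstar : ℝ) + (ℓin : ℝ) / Real.logb 2 (n : ℝ))
            ≤ C * Real.logb 2 (n : ℝ) →
        (ℓin : ℝ) ≤ C * (n : ℝ) →
        (ℓout : ℝ) ≤ C * Real.logb 2 (n : ℝ) →
        (idBits : ℝ) ≤ C * Real.logb 2 (n : ℝ) →
        (Δstar ≠ 1 ∨ (τ : ℝ) ≤ C) →
        ∀ A : LocalAlgorithm,
          ∃ R : ℕ, R ≤ K ∧ ∃ S : CliqueAlgorithm (K * Nat.clog 2 n),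
            ∀ I : NetworkInstance n idBits Δstar ρ ℓin,
              A.OnlyReceivesFromNstar I τ →
              (∀ v, (A.outputAfter I τ v).length ≤ ℓout) →
              1 - 1 / (n : ℝ) ^ c ≤
                S.coinProb n {coins | ∀ v, S.outputAfter I coins R v = A.outputAfter I τ v} := by

  intro C c
  obtain ⟨K, hK⟩ := exists_simulation (⌈C⌉₊ + 1) (by omega)
  have hC : C ≤ ((⌈C⌉₊ + 1 : ℕ) : ℝ) := by
    push_cast
    linarith [Nat.le_ceil C]
  refine ⟨K, fun n τ Δstar ℓin ℓout ρ idBits h hin hout hid hΔτ A => ?_⟩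
  have hlog : 0 ≤ Real.logb 2 (n : ℝ) := by
    rcases Nat.eq_zero_or_pos n with rfl | hn
    · simp
    · exact Real.logb_nonneg one_lt_two (by exact_mod_cast hn)
  obtain ⟨R, hR, S, hS⟩ := hK n τ Δstar ℓin ℓout ρ idBits
    (h.trans (mul_le_mul_of_nonneg_right hC hlog))
    (hin.trans (mul_le_mul_of_nonneg_right hC (Nat.cast_nonneg n)))
    (hout.trans (mul_le_mul_of_nonneg_right hC hlog))
    (hid.trans (mul_le_mul_of_nonneg_right hC hlog))
    (hΔτ.imp_right fun hτ => by exact_mod_cast hτ.trans hC) A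
  refine ⟨R, hR, S, fun I hA hlen => ?_⟩
  -- The simulation succeeds for all coins, so the probability is one for every `c`.
  have huniv : {coins | ∀ v, S.outputAfter I coins R v = A.outputAfter I τ v} = Set.univ :=
    Set.eq_univ_of_forall fun coins => hS I hA hlen coins
  rw [huniv, S.coinProb_univ, sub_le_self_iff]
  positivity
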